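/- **Setting.** $N$ agents with decision variables $x_i\in\mathbb R^{n_i}$, $x=\mathrm{col}(x_1,\dots,x_N)\in\mathbb R^n$, minimize $f_\sigma(x)=\sum_{i=1}^N f_i(x_i,\sigma(x))$, where $\sigma(x)=\frac1N\sum_{i=1}^N\phi_i(x_i)\in\mathbb R^d$, $f_i:\mathbb R^{n_i}\times\mathbb R^d\to\mathbb R$ and $\phi_i:\mathbb R^{n_i}\to\mathbb R^d$ are differentiable. Each agent has a parametrized proxy (neural network) $\hat f_i:\mathbb R^{n_i}\times\mathbb R^d\times\mathbb R^{m_i}\to\mathbb R$, a sample loss $\ell_i:\mathbb R^{n_i}\times\mathbb R^d\times\mathbb R^{m_i}\to\mathbb R$, differentiable in its last argument, and dither sequences $d_{x,i}^k\in\mathbb R^{n_i}$, $d_{\sigma,i}^k\in\mathbb R^d$. All norms are Euclidean, $\nabla_c$ is the gradient in the $c$-th argument, $\nabla\phi_i$ is the transposed Jacobian, and $\mathcal B_r(v)$ is the closed ball. With step size $\gamma>0$, weights $a_{ij}$, and $s_i^k:=w_i^k+\phi_i(x_i^k)$, $\hat u_{2,i}^k:=\nabla_2\hat f_i(x_i^k,s_i^k,\theta_i^k)$,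 the algorithm is, for $i=1,\dots,N$ and $k\in\mathbb N$, $$\begin{aligned} \theta_i^{k+1}&=\theta_i^k-\gamma\nabla_3\ell_i(x_i^k+d_{x,i}^k,\;s_i^k+d_{\sigma,i}^k,\;\theta_i^k),\\ x_i^{k+1}&=x_i^k-\gamma\big[\nabla_1\hat f_i(x_i^k,s_i^k,\theta_i^k)+\nabla\phi_i(x_i^k)\,(z_i^k+\hat u_{2,i}^k)\big],\\ w_i^{k+1}&=\textstyle\sum_j a_{ij}\,(w_j^k+\phi_j(x_j^k))-\phi_i(x_i^k),\\ z_i^{k+1}&=\textstyle\sum_j a_{ij}\,(z_j^k+\hat u_{2,j}^k)-\hat u_{2,i}^k . \end{aligned}$$ **Assumptions.** (1) $f_\sigma$ is $\mu_f$-strongly convex and differentiable with $L$-Lipschitz gradient; $\nabla_1f_i$, $\nabla_2f_i$, $\phi_i$ are Lipschitz with constants $L_x,L_\sigma,L_\phi$; $\mu_f,L,L_x,L_\sigma,L_\phi>0$. Let $x^\star$ be the minimizer of $f_\sigma$. (2) The matrix $(a_{ij})$ is nonnegative and doubly stochastic, and the graph with an edge $(j,i)$ whenever $a_{ij}>0$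 is strongly connected and aperiodic. (3) Each $\hat f_i$ is differentiable, and $\nabla_1\hat f_i$, $\nabla_2\hat f_i$ are Lipschitz (jointly in all arguments) with constants $\hat L_x,\hat L_\sigma>0$. (4) For an integer $K\ge1$ the dithers are $K$-periodic. There are $\theta_i^\star\in\mathbb R^{m_i}$, $\bar r_i>0$ such that for all $(u,v)\in\mathbb R^{n_i}\times\mathbb R^d$ the function $\theta_i\mapsto\frac1K\sum_{\tau=1}^K\ell_i(u+d_{x,i}^\tau,v+d_{\sigma,i}^\tau,\theta_i)$ is $\mu_\ell$-strongly convex on $\mathcal B_{\bar r_i}(\theta_i^\star)$ and is minimized over this ball at $\theta_i^\star$; $\nabla_3\ell_i$ is $L_\ell$-Lipschitz jointly in all arguments; $\mu_\ell,L_\ell>0$. (5) For some $\epsilon\ge0$ there are functions $p_{1,i}(x)$, $p_{2,i}(x)$, $p_{\ell,i}(x,k)$, Lipschitz in $x\in\mathbb R^n$ and of norm at most $\epsilon$, such that for all $x\in\mathbb R^n$, $k\in\{1,\dots,K\}$ and all $i$: $\nabla_c\hat f_i(x_i,\sigma(x),\theta_i^\star)=\nabla_cf_i(x_i,\sigma(x))+p_{c,i}(x)$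 for $c=1,2$, and $\nabla_3\ell_i(x_i+d_{x,i}^k,\sigma(x)+d_{\sigma,i}^k,\theta_i^\star)=p_{\ell,i}(x,k)$. Let $\Xi(x,w,z,\theta)$ be the stacked vector with blocks $x-x^\star$; $\;w_i+\phi_i(x_i)-\sigma(x)$ for $i=1,\dots,N$; $\;z_i+\hat u_{2,i}-\frac1N\sum_j\hat u_{2,j}$ for $i=1,\dots,N$, with $\hat u_{2,i}=\nabla_2\hat f_i(x_i,w_i+\phi_i(x_i),\theta_i)$; and $\theta-\theta^\star$. **Theorem.** Fix the problem ($f_i$, $\phi_i$, $(a_{ij})$ as in (1), (2)), the constants $\hat L_x,\hat L_\sigma,\mu_\ell,L_\ell>0$ and $K\ge1$. There are constants $B,\kappa_1>0$ and, for every $\gamma>0$, a number $\kappa_2=\kappa_2(\gamma)\in(0,1)$, such that the following holds for all $m_i,\hat f_i,\ell_i$, dithers, $\theta_i^\star,\bar r_i,\epsilon$ satisfying (3)–(5) and all initial states with $\theta_i^0\in\mathcal B_{\bar r_i}(\theta_i^\star)$, $x_i^0\in\mathbb R^{n_i}$ and $w_i^0=z_i^0=0$ for all $i$: there is $\bar\gamma>0$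 such that for every $\gamma\in(0,\bar\gamma)$ and every $k\in\mathbb N$, $$\|x^k-x^\star\|\le\kappa_1\,\kappa_2(\gamma)^k\,\|\Xi(x^0,w^0,z^0,\theta^0)\|+\epsilon B .$$ In particular the convergence to $x^\star$ is exact and linear if $\epsilon=0$. -/

import Mathlib

noncomputable section

namespace AggLearn

/-- `ℝ^k` with its Euclidean norm. -/
abbrev Vec (k : ℕ) : Type := EuclideanSpace ℝ (Fin k)

/-- Stacked vectors `col(v_1, …, v_N)` with blocks `v_i ∈ ℝ^(b i)`, with the Euclidean norm. -/
abbrev Stack {N : ℕ} (b : Fin N → ℕ) : Type := PiLp 2 (fun i : Fin N => Vec (b i))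

/-- Joint `C`-Lipschitz continuity of a function of two vectors, for the Euclidean norm of the
stacked argument. -/
def Lip2 {a b c : ℕ} (C : ℝ) (G : Vec a → Vec b → Vec c) : Prop :=
  ∀ (u u' : Vec a) (v v' : Vec b),
    ‖G u v - G u' v'‖ ≤ C * Real.sqrt (‖u - u'‖ ^ 2 + ‖v - v'‖ ^ 2)

/-- Joint `C`-Lipschitz continuity of a function of three vectors, for the Euclidean norm of the
stacked argument. -/
def Lip3 {a b c e : ℕ} (C : ℝ) (G : Vec a → Vec b → Vec c → Vec e) : Prop :=
  ∀ (u u' : Vec a) (v v' : Vec b) (t t' : Vec c),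
    ‖G u v t - G u' v' t'‖ ≤ C * Real.sqrt (‖u - u'‖ ^ 2 + ‖v - v'‖ ^ 2 + ‖t - t'‖ ^ 2)

/-- The data of an aggregative problem over a network of `N` agents: local costs `f i`,
contributions `φ i` to the aggregative variable, and the weighted adjacency matrix `A`. -/
structure Problem (N : ℕ) (n : Fin N → ℕ) (d : ℕ) where
  f : ∀ i, Vec (n i) → Vec d → ℝ
  φ : ∀ i, Vec (n i) → Vec d
  A : Matrix (Fin N) (Fin N) ℝ

namespace Problem

variable {N : ℕ} {n : Fin N → ℕ} {d : ℕ} (P : Problem N n d)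

/-- The aggregative variable `σ(x) = (1/N) ∑ φ_i(x_i)`. -/
def agg (x : Stack n) : Vec d := (1 / (N : ℝ)) • ∑ i, P.φ i (x i)

/-- The global cost `x ↦ ∑ f_i(x_i, σ(x))`. -/
def cost (x : Stack n) : ℝ := ∑ i, P.f i (x i) (P.agg x)

/-- `∇₁ f_i`. -/
def grad₁ (i : Fin N) (u : Vec (n i)) (v : Vec d) : Vec (n i) :=
  gradient (fun s => P.f i s v) u

/-- `∇₂ f_i`. -/
def grad₂ (i : Fin N) (u : Vec (n i)) (v : Vec d) : Vec d :=
  gradient (fun s => P.f i u s) v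

/-- `∇φ_i(u)`, the transposed Jacobian of `φ_i` at `u`, as a linear map `ℝ^d → ℝ^(n i)`. -/
def gradφ (i : Fin N) (u : Vec (n i)) : Vec d →L[ℝ] Vec (n i) :=
  ContinuousLinearMap.adjoint (fderiv ℝ (P.φ i) u)

/-- Regularity of the costs: the global cost is `μf`-strongly convex with `L`-Lipschitz gradient,
and `∇₁ f_i`, `∇₂ f_i`, `φ_i` are Lipschitz with constants `Lx`, `Lσ`, `Lφ`. -/
structure Regular (μf L Lx Lσ Lφ : ℝ) : Prop where
  μf_pos : 0 < μf
  L_pos : 0 < L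
  Lx_pos : 0 < Lx
  Lσ_pos : 0 < Lσ
  Lφ_pos : 0 < Lφ
  diff_f : ∀ i, Differentiable ℝ (fun q : Vec (n i) × Vec d => P.f i q.1 q.2)
  diff_φ : ∀ i, Differentiable ℝ (P.φ i)
  strongConvex : StrongConvexOn Set.univ μf P.cost
  diff_cost : Differentiable ℝ P.cost
  lip_grad_cost : ∀ x y, ‖gradient P.cost x - gradient P.cost y‖ ≤ L * ‖x - y‖
  lip_grad₁ : ∀ i, Lip2 Lx (P.grad₁ i)
  lip_grad₂ : ∀ i, Lip2 Lσ (P.grad₂ i)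
  lip_φ : ∀ i u v, ‖P.φ i u - P.φ i v‖ ≤ Lφ * ‖u - v‖

/-- The communication graph has an edge `(j, i)` exactly when `A i j > 0`. The weights are doubly
stochastic and the graph is strongly connected and aperiodic (`IsPrimitive`: some power of `A` has
only positive entries). -/
structure GoodGraph : Prop where
  doublyStochastic : P.A ∈ doublyStochastic ℝ (Fin N)
  stronglyConnected : P.A.IsIrreducible
  aperiodic : P.A.IsPrimitive

end Problem

/-- The learning components: for each agent a parametrized proxy `fhat i` with `m i` parameters
(the neural network), a sample loss `ℓ i`, and the two dither sequences `dx i`, `dσ i`. -/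
structure Learner (N : ℕ) (n : Fin N → ℕ) (d : ℕ) (m : Fin N → ℕ) where
  fhat : ∀ i, Vec (n i) → Vec d → Vec (m i) → ℝ
  ℓ : ∀ i, Vec (n i) → Vec d → Vec (m i) → ℝ
  dx : ∀ i, ℕ → Vec (n i)
  dσ : ∀ _ : Fin N, ℕ → Vec d

namespace Learner

variable {N : ℕ} {n : Fin N → ℕ} {d : ℕ} {m : Fin N → ℕ} (Q : Learner N n d m)

/-- `∇₁ fhat_i`. -/
def grad₁ (i : Fin N) (u : Vec (n i)) (v : Vec d) (t : Vec (m i)) : Vec (n i) :=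
  gradient (fun s => Q.fhat i s v t) u

/-- `∇₂ fhat_i`. -/
def grad₂ (i : Fin N) (u : Vec (n i)) (v : Vec d) (t : Vec (m i)) : Vec d :=
  gradient (fun s => Q.fhat i u s t) v

/-- `∇₃ ℓ_i`. -/
def gradℓ (i : Fin N) (u : Vec (n i)) (v : Vec d) (t : Vec (m i)) : Vec (m i) :=
  gradient (fun s => Q.ℓ i u v s) t

/-- The objective of the learning problem of agent `i` at the frozen pair `(u, v)`: the average
of the sample loss over one period of the dithers. -/
def avgLoss (K : ℕ) (i : Fin N) (u : Vec (n i)) (v : Vec d) (t : Vec (m i)) : ℝ :=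
  (1 / (K : ℝ)) * ∑ τ ∈ Finset.Icc 1 K, Q.ℓ i (u + Q.dx i τ) (v + Q.dσ i τ) t

/-- The proxies are differentiable, with Lipschitz partial gradients. -/
structure SmoothProxies (Lhx Lhσ : ℝ) : Prop where
  diff : ∀ i, Differentiable ℝ
    (fun q : Vec (n i) × Vec d × Vec (m i) => Q.fhat i q.1 q.2.1 q.2.2)
  lip_grad₁ : ∀ i, Lip3 Lhx (Q.grad₁ i)
  lip_grad₂ : ∀ i, Lip3 Lhσ (Q.grad₂ i)

/-- The dithers are `K`-periodic; for every frozen pair the learning problem is `μℓ`-strongly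
convex on the closed ball of radius `rbar i` around `θstar i` and minimized over this ball at
`θstar i`; the loss gradients `∇₃ ℓ_i` are `Lℓ`-Lipschitz. -/
structure GoodLearning (K : ℕ) (μℓ Lℓ : ℝ) (θstar : Stack m) (rbar : Fin N → ℝ) : Prop where
  rbar_pos : ∀ i, 0 < rbar i
  periodic_dx : ∀ i τ, Q.dx i (τ + K) = Q.dx i τ
  periodic_dσ : ∀ i τ, Q.dσ i (τ + K) = Q.dσ i τ
  strongConvex : ∀ i u v,
    StrongConvexOn (Metric.closedBall (θstar i) (rbar i)) μℓ (Q.avgLoss K i u v)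
  isMin : ∀ i u v,
    IsMinOn (Q.avgLoss K i u v) (Metric.closedBall (θstar i) (rbar i)) (θstar i)
  diff_ℓ : ∀ i u v, Differentiable ℝ (Q.ℓ i u v)
  lip_gradℓ : ∀ i, Lip3 Lℓ (Q.gradℓ i)

/-- Reconstruction accuracy `ε` at the parameters `θstar`: the errors `p₁`, `p₂`, `pℓ` are
Lipschitz functions of `x` and are bounded by `ε`. -/
def Reconstructs (P : Problem N n d) (K : ℕ) (θstar : Stack m) (ε : ℝ) : Prop :=
  ∀ i, ∃ (p₁ : Stack n → Vec (n i)) (p₂ : Stack n → Vec d) (pℓ : Stack n → ℕ → Vec (m i)),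
    (∃ C, LipschitzWith C p₁) ∧ (∃ C, LipschitzWith C p₂) ∧
    (∃ C, ∀ k ∈ Finset.Icc 1 K, LipschitzWith C (fun x => pℓ x k)) ∧
    ∀ x : Stack n, ∀ k ∈ Finset.Icc 1 K,
      Q.grad₁ i (x i) (P.agg x) (θstar i) = P.grad₁ i (x i) (P.agg x) + p₁ x ∧
      Q.grad₂ i (x i) (P.agg x) (θstar i) = P.grad₂ i (x i) (P.agg x) + p₂ x ∧
      Q.gradℓ i (x i + Q.dx i k) (P.agg x + Q.dσ i k) (θstar i) = pℓ x k ∧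
      ‖p₁ x‖ ≤ ε ∧ ‖p₂ x‖ ≤ ε ∧ ‖pℓ x k‖ ≤ ε

end Learner

/-- The state of the algorithm: network parameters `θ`, decision estimates `x`, and the trackers
`w` (of the aggregative variable) and `z` (of the gradient with respect to it). -/
structure State (N : ℕ) (n : Fin N → ℕ) (d : ℕ) (m : Fin N → ℕ) where
  θ : Stack m
  x : Stack n
  w : Stack (fun _ : Fin N => d)
  z : Stack (fun _ : Fin N => d)

section Algorithm

variable {N : ℕ} {n : Fin N → ℕ} {d : ℕ} {m : Fin N → ℕ}
  (P : Problem N n d) (Q : Learner N n d m)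

/-- Agent `i`'s estimate `w_i + φ_i(x_i)` of the aggregative variable. -/
def State.sig (S : State N n d m) (i : Fin N) : Vec d := S.w i + P.φ i (S.x i)

/-- `∇₁ fhat_i` at the current estimates of agent `i`. -/
def State.u₁ (S : State N n d m) (i : Fin N) : Vec (n i) :=
  Q.grad₁ i (S.x i) (S.sig P i) (S.θ i)

/-- `∇₂ fhat_i` at the current estimates of agent `i`. -/
def State.u₂ (S : State N n d m) (i : Fin N) : Vec d :=
  Q.grad₂ i (S.x i) (S.sig P i) (S.θ i)

/-- One iteration, with step size `γ`, at time `k`: learning, optimization and tracking updates.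
Weights vanish off the in-neighbours, so the consensus sums range over all agents. -/
def step (γ : ℝ) (k : ℕ) (S : State N n d m) : State N n d m where
  θ := WithLp.toLp 2 fun i =>
    S.θ i - γ • Q.gradℓ i (S.x i + Q.dx i k) (S.sig P i + Q.dσ i k) (S.θ i)
  x := WithLp.toLp 2 fun i =>
    S.x i - γ • (S.u₁ P Q i + P.gradφ i (S.x i) (S.z i + S.u₂ P Q i))
  w := WithLp.toLp 2 fun i => ∑ j, P.A i j • (S.w j + P.φ j (S.x j)) - P.φ i (S.x i)
  z := WithLp.toLp 2 fun i => ∑ j, P.A i j • (S.z j + S.u₂ P Q j) - S.u₂ P Q i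

/-- The sequence of states generated by the algorithm from the initial state `S₀`. -/
def traj (γ : ℝ) (S₀ : State N n d m) : ℕ → State N n d m
  | 0 => S₀
  | k + 1 => step P Q γ k (traj γ S₀ k)

/-- The stacked error vector `Ξ(x, w, z, θ)`, in the Euclidean direct sum of the four spaces. -/
def errVec (xstar : Stack n) (θstar : Stack m) (S : State N n d m) :
    WithLp 2 (Stack n × WithLp 2 (Stack (fun _ : Fin N => d) ×
      WithLp 2 (Stack (fun _ : Fin N => d) × Stack m))) :=
  WithLp.toLp 2 (S.x - xstar,
    WithLp.toLp 2 (WithLp.toLp 2 (fun i => S.w i + P.φ i (S.x i) - P.agg S.x),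
      WithLp.toLp 2
        (WithLp.toLp 2 (fun i => S.z i + (S.u₂ P Q i - (1 / (N : ℝ)) • ∑ j, S.u₂ P Q j)),
          S.θ - θstar)))

end Algorithm

end AggLearn

end

/-! In suitable coordinates the algorithm is a family of contractions with weak coupling. The
decision update is a gradient step for the global cost, perturbed by γ times the consensus, tracking
and learning errors plus ε. The consensus errors of both trackers keep zero sum, because `w` and `z`
start at zero, and primitive doubly stochastic weights contract zero-sum families at a rate ρ < 1
independent of γ, in an adapted norm (`exists_adapted_norm`). Learning uses one dither per step,
whereas only the average of the sample gradients over a period is monotone; adding γ times a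
periodic corrector to θ gives a step along the averaged gradient, up to terms of order γ² and γ
times the increments of the state (`averaged_step`). The averaged gradient vanishes at θ⋆ for every
frozen pair.

`exists_errStep` collects these facts into the scalar inequalities `ErrStep`. A weighted sum of the
four errors then contracts by 1 - κγ up to γDε (`exists_weights`), which yields the rate and the
residual εD/κ.

The delicate point is that strong convexity holds only on given balls and θ⁰ may lie on their
boundary. Monotonicity survives, with a smaller constant, on balls enlarged by a factor 1 + η
(`le_inner_of_mem_enlarged_ball`). The consensus error `b` pushes the learning error by γCb with `b`
not small, but `b` decays geometrically up to order γ, so π + γGb is a barrier (`barrier_step`) that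
keeps the parameters inside for small γ. `errStep_bound` proves decay and invariance in a single
induction; its threshold on γ depends on radii, accuracy and initial errors, its constants do not.
-/

noncomputable section

namespace AggLearn

/-! ### Scalar error recursions, Lyapunov weights and the invariance barrier -/

section Scalars
open Filter Topology

lemma eventually_mul_le (X : ℝ) {Y : ℝ} (hY : 0 < Y) : ∀ᶠ γ : ℝ in 𝓝[>] 0, γ * X ≤ Y := by
  have h : Tendsto (fun γ : ℝ => γ * X) (𝓝[>] 0) (𝓝 0) := by
    have : Tendsto (fun γ : ℝ => γ * X) (𝓝 0) (𝓝 (0 * X)) :=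
      (continuous_id.mul continuous_const).tendsto 0
    rw [zero_mul] at this
    exact this.mono_left nhdsWithin_le_nhds
  exact h.eventually_le_const hY

/-- One step of the coupled error recursion: optimization error `a`, consensus errors `b` and `c`,
averaged learning error `p`, accuracy `ε`. -/
structure ErrStep (α ν ρ C γ ε a b c p a' b' c' p' : ℝ) : Prop where
  a_le : a' ≤ (1 - γ * α) * a + γ * C * (b + c + p + ε)
  b_le : b' ≤ ρ * b + γ * C * (a + b + c + p + ε)
  c_le : c' ≤ ρ * c + C * b + γ * C * (a + b + c + p + ε)
  p_le : p' ≤ (1 - γ * ν) * p + γ * C * b + γ ^ 2 * C * (a + b + c + p + ε)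

/-- A weighted sum of the errors contracts, up to a perturbation proportional to `ε`. -/
lemma exists_weights {α ν ρ C : ℝ} (hα : 0 < α) (hν : 0 < ν) (hρ : ρ < 1) (hC : 1 ≤ C) :
    ∃ l₁ l₂ l₃ κ D : ℝ, 0 < l₁ ∧ 0 < l₂ ∧ 0 < l₃ ∧ 0 < κ ∧ 0 < D ∧
      ∀ᶠ γ : ℝ in 𝓝[>] 0, ∀ ε a b c p a' b' c' p' : ℝ, 0 ≤ ε → 0 ≤ a → 0 ≤ b → 0 ≤ c → 0 ≤ p →
        ErrStep α ν ρ C γ ε a b c p a' b' c' p' →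
        a' + l₁ * p' + l₂ * c' + l₃ * b' ≤
          (1 - κ * γ) * (a + l₁ * p + l₂ * c + l₃ * b) + γ * D * ε := by
  have hC0 : 0 < C := by linarith
  have hδ : 0 < 1 - ρ := by linarith
  -- Both `l₃` and `l₂` are small against α/C, so that `a` still contracts at order γ. In addition
  -- `l₂` is small against `l₃`, because `c` receives C b without a factor γ. In contrast `l₁` is
  -- large, so that the decay of `p` pays for its effect γ C p on `a`; this is affordable because
  -- `a` feeds `p` only at order γ².
  obtain ⟨l₃, h3⟩ : ∃ l₃, l₃ = α / (8 * C) := ⟨_, rfl⟩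
  obtain ⟨l₂, h2⟩ : ∃ l₂, l₂ = min l₃ (l₃ * (1 - ρ) / (4 * C)) := ⟨_, rfl⟩
  obtain ⟨l₁, h1⟩ : ∃ l₁, l₁ = 4 * (C + α) / ν := ⟨_, rfl⟩
  obtain ⟨κ, hκ⟩ : ∃ κ, κ = min (α / 2) (ν / 2) := ⟨_, rfl⟩
  have l3p : 0 < l₃ := by rw [h3]; positivity
  have l2p : 0 < l₂ := by rw [h2]; positivity
  have l1p : 0 < l₁ := by rw [h1]; positivity
  have κp : 0 < κ := by rw [hκ]; positivity
  have e3 : C * l₃ = α / 8 := by rw [h3]; field_simp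
  have e2 : l₂ ≤ l₃ := h2 ▸ min_le_left _ _
  have e2' : C * l₂ ≤ l₃ * (1 - ρ) / 4 := by
    have : l₂ ≤ l₃ * (1 - ρ) / (4 * C) := h2 ▸ min_le_right _ _
    calc C * l₂ ≤ C * (l₃ * (1 - ρ) / (4 * C)) := by gcongr
      _ = _ := by field_simp
  have e1 : l₁ * ν = 4 * (C + α) := by rw [h1]; field_simp
  have k1 : κ ≤ α / 2 := hκ ▸ min_le_left _ _
  have k2 : κ ≤ ν / 2 := hκ ▸ min_le_right _ _
  have e4 : C * (l₂ + l₃) ≤ α / 4 := by nlinarith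
  refine ⟨l₁, l₂, l₃, κ, C * (1 + l₁ + l₂ + l₃), l1p, l2p, l3p, κp, by positivity, ?_⟩
  filter_upwards [self_mem_nhdsWithin, eventually_mul_le (l₁ * C) (Y := α / 4) (by positivity),
    eventually_mul_le C (Y := ν / 4) (by positivity),
    eventually_mul_le 1 (Y := 1) one_pos,
    eventually_mul_le (C + C * l₂ + C * l₃ + l₁ * C + κ * l₂) (Y := l₂ * (1 - ρ)) (by positivity),
    eventually_mul_le (C + C * l₂ + C * l₃ + l₁ * C + l₁ * C + κ * l₃) (Y := l₃ * (1 - ρ) / 2)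
      (by positivity)] with γ hγ g1 g2 g3 g4 g5
  have hγ : 0 < γ := hγ
  intro ε a b c p a' b' c' p' hε ha hb hc hp ⟨sa, sb, sc, sp⟩
  have hγγ : γ ^ 2 ≤ γ := by
    have := mul_le_mul_of_nonneg_left g3 hγ.le
    linarith
  have hq : γ ^ 2 * (l₁ * C) ≤ γ * (l₁ * C) := by gcongr
  have ca : 1 - γ * α + γ * C * (l₂ + l₃) + l₁ * (γ ^ 2 * C) ≤ 1 - κ * γ := by
    linarith [mul_le_mul_of_nonneg_left g1 hγ.le, mul_le_mul_of_nonneg_left e4 hγ.le,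
      mul_le_mul_of_nonneg_left k1 hγ.le]
  have cp : γ * C + l₁ * (1 - γ * ν) + l₁ * (γ ^ 2 * C) + γ * C * (l₂ + l₃)
      ≤ l₁ * (1 - κ * γ) := by
    have i1 : γ * (γ * C) ≤ γ * (ν / 4) := by gcongr
    have i2 := mul_le_mul_of_nonneg_left i1 l1p.le
    have i3 := mul_le_mul_of_nonneg_left (mul_le_mul_of_nonneg_left k2 hγ.le) l1p.le
    have i4 := mul_le_mul_of_nonneg_left e4 hγ.le
    have i5 : γ * (l₁ * ν) = γ * (4 * (C + α)) := by rw [e1]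
    linarith [mul_pos hγ hα, mul_pos hγ hC0]
  have cc : γ * C + l₂ * ρ + γ * C * (l₂ + l₃) + l₁ * (γ ^ 2 * C) ≤ l₂ * (1 - κ * γ) := by
    linarith
  have cb : γ * C + l₁ * (γ * C) + l₁ * (γ ^ 2 * C) + l₂ * C + γ * C * (l₂ + l₃) + l₃ * ρ
      ≤ l₃ * (1 - κ * γ) := by
    linarith [mul_pos l3p hδ]
  have ce : γ * C + l₁ * (γ ^ 2 * C) + γ * C * (l₂ + l₃) ≤ γ * (C * (1 + l₁ + l₂ + l₃)) := by
    linarith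
  have ta := mul_le_mul_of_nonneg_right ca ha
  have tp := mul_le_mul_of_nonneg_right cp hp
  have tc := mul_le_mul_of_nonneg_right cc hc
  have tb := mul_le_mul_of_nonneg_right cb hb
  have te := mul_le_mul_of_nonneg_right ce hε
  have s1 := mul_le_mul_of_nonneg_left sp l1p.le
  have s2 := mul_le_mul_of_nonneg_left sc l2p.le
  have s3 := mul_le_mul_of_nonneg_left sb l3p.le
  linarith

/-- Invariance of a sublevel set of `π + γ G b`, where `b` drives `π` and decays geometrically up
to a perturbation of order `γ`. -/
lemma barrier_step {ν ρ C γ G H E b b' b₀ π π' r : ℝ} (hν : 0 ≤ ν) (hγ : 0 ≤ γ)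
    (hG : 0 ≤ G) (hb : 0 ≤ b) (hr : 0 ≤ r) (hb₀ : 0 ≤ b₀) (eG : G * (1 - ρ) = 2 * C)
    (h1 : γ * ν ≤ 1) (h2 : γ * ν ≤ (1 - ρ) / 2) (eH : H * ν = C * (1 + G) * E)
    (hπ' : π' ≤ (1 - γ * ν) * π + γ * C * b + γ ^ 2 * C * E)
    (hb' : b' ≤ ρ * b + γ * C * E) (h : π + γ * G * b ≤ r + γ * (G * b₀ + H)) :
    π' + γ * G * b' ≤ r + γ * (G * b₀ + H) := by
  have v2 := mul_le_mul_of_nonneg_left hb' (mul_nonneg hγ hG)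
  -- The gap G (1 - ρ) = 2C is spent twice: one C pays for the drive of π by `b`, the other for the
  -- requested decay, as G γ ν ≤ C. The constant `H` is chosen so that the remaining forcing γ² C (1
  -- + G) E equals γ ν times γ H.
  have v3 : C + G * ρ ≤ G * (1 - γ * ν) := by
    have := mul_le_mul_of_nonneg_left h2 hG
    linarith
  have v4 := mul_le_mul_of_nonneg_left v3 (mul_nonneg hγ hb)
  have v5 := mul_le_mul_of_nonneg_left h (show 0 ≤ 1 - γ * ν by linarith)
  have v6 : γ ^ 2 * (H * ν) = γ ^ 2 * (C * (1 + G) * E) := by rw [eH]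
  have v7 : 0 ≤ γ * ν * (r + γ * (G * b₀)) := by positivity
  linarith

/-- The error recursion gives linear convergence up to a multiple of `ε`, even if it is only known
to hold while the learning errors `π i` stay in balls slightly larger than their initial balls. -/
lemma errStep_bound {α ν ρ C η : ℝ} (hα : 0 < α) (hν : 0 < ν) (hρ : ρ < 1)
    (hC : 1 ≤ C) (hη : 0 < η) :
    ∃ κ M B : ℝ, 0 < κ ∧ 0 < M ∧ 0 < B ∧
      ∀ (N : ℕ) (r : Fin N → ℝ), (∀ i, 0 < r i) → ∀ ε a₀ b₀ c₀ p₀ : ℝ, 0 ≤ ε →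
      ∀ᶠ γ : ℝ in 𝓝[>] 0, ∀ (a b c p : ℕ → ℝ) (π : ℕ → Fin N → ℝ),
        a 0 = a₀ → b 0 = b₀ → c 0 = c₀ → p 0 = p₀ →
        (∀ k, 0 ≤ a k) → (∀ k, 0 ≤ b k) → (∀ k, 0 ≤ c k) → (∀ k, 0 ≤ p k) →
        (∀ i, π 0 i ≤ r i) →
        (∀ k, (∀ i, π k i ≤ (1 + η) * r i) →
          ErrStep α ν ρ C γ ε (a k) (b k) (c k) (p k) (a (k + 1)) (b (k + 1)) (c (k + 1))
            (p (k + 1)) ∧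
          ∀ i, π (k + 1) i ≤ (1 - γ * ν) * π k i + γ * C * b k
            + γ ^ 2 * C * (a k + b k + c k + p k + ε)) →
        ∀ k, a k ≤ M * (1 - κ * γ) ^ k * (a₀ + b₀ + c₀ + p₀) + ε * B := by
  obtain ⟨l₁, l₂, l₃, κ, D, l1p, l2p, l3p, κp, Dp, hV⟩ := exists_weights hα hν hρ hC
  have hC0 : 0 < C := by linarith
  have hδ : 0 < 1 - ρ := by linarith
  -- ε D / κ is the fixed point of V ↦ (1 - κ γ) V + γ D ε, hence independent of γ.
  refine ⟨κ, 1 + l₁ + l₂ + l₃, D / κ, κp, by positivity, by positivity, ?_⟩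
  intro N r hr ε a₀ b₀ c₀ p₀ hε
  obtain ⟨V₀, hV₀⟩ : ∃ V₀, V₀ = a₀ + l₁ * p₀ + l₂ * c₀ + l₃ * b₀ := ⟨_, rfl⟩
  -- `R` bounds the Lyapunov function at all times, uniformly in γ. The absolute value is needed
  -- because the sign of `V₀` is known only once the sequences are given, after γ.
  obtain ⟨R, hR⟩ : ∃ R, R = |V₀| + ε * (D / κ) := ⟨_, rfl⟩
  obtain ⟨E, hE⟩ : ∃ E, E = R + R / l₃ + R / l₂ + R / l₁ + ε := ⟨_, rfl⟩
  obtain ⟨G, hG⟩ : ∃ G, G = 2 * C / (1 - ρ) := ⟨_, rfl⟩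
  have G0 : 0 < G := by rw [hG]; positivity
  have eG : G * (1 - ρ) = 2 * C := by rw [hG]; field_simp
  have R0 : 0 ≤ R := by rw [hR]; positivity
  have E0 : 0 ≤ E := by rw [hE]; positivity
  obtain ⟨H, hH⟩ : ∃ H, H = C * (1 + G) * E / ν := ⟨_, rfl⟩
  have H0 : 0 ≤ H := by rw [hH]; positivity
  have eH : H * ν = C * (1 + G) * E := by rw [hH]; field_simp
  have hball : ∀ᶠ γ : ℝ in 𝓝[>] 0, ∀ i, γ * (G * b₀ + H) ≤ η * r i :=
    eventually_all.2 fun i => eventually_mul_le _ (mul_pos hη (hr i))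
  filter_upwards [self_mem_nhdsWithin, hV, hball, eventually_mul_le κ (Y := 1) one_pos,
    eventually_mul_le ν (Y := 1) one_pos,
    eventually_mul_le ν (Y := (1 - ρ) / 2) (by positivity)] with γ hγ hVγ hb g1 g2 g3
  have hγ : 0 < γ := hγ
  intro a b c p π ha0 hb0 hc0 hp0 ha hb' hc hp hπ0 hstep
  have V0n : 0 ≤ V₀ := by
    have := ha 0; have := hb' 0; have := hc 0; have := hp 0
    rw [hV₀, ← ha0, ← hb0, ← hc0, ← hp0]; positivity
  have b0n : 0 ≤ b₀ := hb0 ▸ hb' 0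
  have key : ∀ k, (a k + l₁ * p k + l₂ * c k + l₃ * b k
        ≤ (1 - κ * γ) ^ k * V₀ + ε * (D / κ)) ∧
      ∀ i, π k i + γ * G * b k ≤ r i + γ * (G * b₀ + H) := by
    intro k
    induction k with
    | zero =>
      refine ⟨?_, fun i => ?_⟩
      · rw [ha0, hb0, hc0, hp0, pow_zero, one_mul, ← hV₀]
        have : 0 ≤ ε * (D / κ) := by positivity
        linarith
      · rw [hb0]
        have := hπ0 i
        have : 0 ≤ γ * H := mul_nonneg hγ.le H0
        linarith
    | succ k ih =>
      -- The barrier puts the state in the enlarged balls, so the recursion applies; the Lyapunov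
      -- bound in turn bounds the forcing in the barrier by `E`.
      obtain ⟨ihV, ihW⟩ := ih
      have hin : ∀ i, π k i ≤ (1 + η) * r i := fun i => by
        have := ihW i; have := hb i
        have : 0 ≤ γ * G * b k := mul_nonneg (mul_nonneg hγ.le G0.le) (hb' k)
        linarith
      obtain ⟨hs, hsi⟩ := hstep k hin
      have h1 := hVγ ε _ _ _ _ _ _ _ _ hε (ha k) (hb' k) (hc k) (hp k) hs
      refine ⟨?_, fun i => ?_⟩
      · have h2 := mul_le_mul_of_nonneg_left ihV (show 0 ≤ 1 - κ * γ by linarith)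
        have h3 : κ * γ * (ε * (D / κ)) = γ * D * ε := by field_simp
        rw [pow_succ]
        linarith
      · have hR' : a k + l₁ * p k + l₂ * c k + l₃ * b k ≤ R := by
          refine ihV.trans ?_
          rw [hR, abs_of_nonneg V0n]
          have : (1 - κ * γ) ^ k ≤ 1 :=
            pow_le_one₀ (by linarith) (by nlinarith [mul_pos κp hγ])
          nlinarith
        have t1 := mul_nonneg l1p.le (hp k)
        have t2 := mul_nonneg l2p.le (hc k)
        have t3 := mul_nonneg l3p.le (hb' k)
        have t0 := ha k
        have u1 : p k ≤ R / l₁ := by rw [le_div_iff₀ l1p]; linarith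
        have u2 : c k ≤ R / l₂ := by rw [le_div_iff₀ l2p]; linarith
        have u3 : b k ≤ R / l₃ := by rw [le_div_iff₀ l3p]; linarith
        have uE : a k + b k + c k + p k + ε ≤ E := by rw [hE]; linarith
        refine barrier_step hν.le hγ.le G0.le (hb' k) (hr i).le b0n eG g2 g3 eH
          ((hsi i).trans ?_) (hs.b_le.trans ?_) (ihW i)
        · gcongr
        · gcongr
  intro k
  have h1 := (key k).1
  have t1 := mul_nonneg l1p.le (hp k)
  have t2 := mul_nonneg l2p.le (hc k)
  have t3 := mul_nonneg l3p.le (hb' k)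
  have hle : V₀ ≤ (1 + l₁ + l₂ + l₃) * (a₀ + b₀ + c₀ + p₀) := by
    have t0 := ha0 ▸ ha 0; have t4 := hc0 ▸ hc 0; have t5 := hp0 ▸ hp 0
    rw [hV₀]
    linarith [mul_nonneg l1p.le t0, mul_nonneg l1p.le b0n, mul_nonneg l1p.le t4,
      mul_nonneg l1p.le t5, mul_nonneg l2p.le t0, mul_nonneg l2p.le b0n, mul_nonneg l2p.le t4,
      mul_nonneg l2p.le t5, mul_nonneg l3p.le t0, mul_nonneg l3p.le b0n, mul_nonneg l3p.le t4,
      mul_nonneg l3p.le t5]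
  have h2 := mul_le_mul_of_nonneg_left hle (pow_nonneg (show 0 ≤ 1 - κ * γ by linarith) k)
  linarith

/-- Elimination of the one-step increments `dx`, `ds`, `dθ` and of the learning error `q` from the
raw estimates. -/
lemma ErrStep.of_increments {α ν ρ C γ ε a b c p q dx ds dθ a' b' c' p' : ℝ} (hC : 1 ≤ C)
    (hγ : 0 < γ) (hγ1 : γ * C ≤ 1 / 2) (hε : 0 ≤ ε) (ha : 0 ≤ a) (hb : 0 ≤ b) (hc : 0 ≤ c)
    (hp : 0 ≤ p) (hq : q ≤ p + γ * C * (b + q + ε))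
    (hdx : dx ≤ γ * C * (a + b + c + q + ε)) (hdθ : dθ ≤ γ * C * (b + q + ε))
    (hds : ds ≤ C * (b + dx))
    (ha' : a' ≤ (1 - γ * α) * a + γ * C * (b + c + q + ε))
    (hb' : b' ≤ ρ * b + C * dx)
    (hc' : c' ≤ ρ * c + C * (dx + ds + dθ))
    (hp' : p' ≤ (1 - γ * ν) * p + γ * C * (dx + ds + dθ) + γ ^ 2 * C * (b + q + ε)) :
    ErrStep α ν ρ (8 * C ^ 3) γ ε a b c p a' b' c' p' := by
  have hC0 : 0 < C := by linarith
  obtain ⟨E, hE⟩ : ∃ E, E = a + b + c + p + ε := ⟨_, rfl⟩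
  have E0 : 0 ≤ E := by rw [hE]; positivity
  have C2 : C ≤ C ^ 2 := by nlinarith
  have C3 : C ^ 2 ≤ C ^ 3 := by nlinarith [sq_nonneg C]
  -- The raw bound has `q` on both sides; γ C ≤ 1/2 absorbs it.
  have q2 : q ≤ 2 * p + b + ε := by
    rcases le_total (b + q + ε) 0 with h | h
    · nlinarith [mul_nonneg_of_nonpos_of_nonpos (a := -1) (by norm_num) h, mul_pos hγ hC0]
    · nlinarith [mul_le_mul_of_nonneg_right hγ1 h]
  have x1 : dx ≤ γ * C * (2 * E) := hdx.trans (by gcongr; linarith only [q2, hE, ha, hb, hc, hp, hε])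
  have x2 : dθ ≤ γ * C * (2 * E) := hdθ.trans (by gcongr; linarith only [q2, hE, ha, hb, hc, hp, hε])
  have x3 : ds ≤ C * b + 2 * γ * C ^ 2 * E := by
    have := mul_le_mul_of_nonneg_left x1 hC0.le
    linarith
  have x4 : dx + ds + dθ ≤ C * b + 6 * γ * C ^ 2 * E := by
    have : γ * C * E ≤ γ * C ^ 2 * E := by gcongr
    linarith
  have y1 : C * (dx + ds + dθ) ≤ C ^ 2 * b + 6 * γ * C ^ 3 * E := by
    have := mul_le_mul_of_nonneg_left x4 hC0.le
    linarith
  have z1 : C ^ 2 * b ≤ C ^ 3 * b := by gcongr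
  have z2 : γ * C ^ 2 * E ≤ γ * C ^ 3 * E := by gcongr
  have z3 : γ * C * E ≤ γ * C ^ 2 * E := by gcongr
  have z4 : 0 ≤ γ * C ^ 3 * E := by positivity
  have z5 : 0 ≤ C ^ 3 * b := by positivity
  refine ⟨?_, ?_, ?_, ?_⟩
  · have w : γ * C * (b + c + q + ε) ≤ γ * (8 * C ^ 3) * (b + c + p + ε) := by
      have : C * (b + c + q + ε) ≤ C * (2 * (b + c + p + ε)) := by gcongr; linarith
      have h2 : C * (b + c + p + ε) ≤ C ^ 3 * (b + c + p + ε) := by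
        gcongr; linarith
      have h3 : 0 ≤ C ^ 3 * (b + c + p + ε) := by positivity
      have : C * (b + c + q + ε) ≤ 8 * C ^ 3 * (b + c + p + ε) := by linarith
      have := mul_le_mul_of_nonneg_left this hγ.le
      linarith
    linarith
  · rw [← hE]
    have := mul_le_mul_of_nonneg_left x1 hC0.le
    linarith
  · rw [← hE]; linarith
  · rw [← hE]
    have h1 := mul_le_mul_of_nonneg_left y1 hγ.le
    have h2 : γ ^ 2 * C * (b + q + ε) ≤ γ ^ 2 * C * (2 * E) := by gcongr; linarith
    have h3 := mul_le_mul_of_nonneg_left z2 hγ.le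
    have h4 := mul_le_mul_of_nonneg_left z3 hγ.le
    have h5 := mul_le_mul_of_nonneg_left z1 hγ.le
    have h6 := mul_nonneg hγ.le z5
    linarith

end Scalars

/-! ### Contraction of consensus errors -/

section Consensus
variable {N : ℕ} {F : Type*} [NormedAddCommGroup F] [NormedSpace ℝ F]

/-- The consensus operator of the weight matrix `A` on families of vectors. -/
def mix (A : Matrix (Fin N) (Fin N) ℝ) (e : Fin N → F) : Fin N → F := fun i => ∑ j, A i j • e j

lemma mix_add (A : Matrix (Fin N) (Fin N) ℝ) (e e' : Fin N → F) :
    mix A (e + e') = mix A e + mix A e' := by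
  ext i; simp [mix, Finset.sum_add_distrib]

lemma mix_mix (A B : Matrix (Fin N) (Fin N) ℝ) (e : Fin N → F) :
    mix A (mix B e) = mix (A * B) e := by
  ext i
  simp only [mix, Finset.smul_sum, smul_smul, Matrix.mul_apply, Finset.sum_smul]
  exact Finset.sum_comm

lemma mix_one (e : Fin N → F) : mix 1 e = e := by
  ext i; simp [mix, Matrix.one_apply]

lemma mix_const {A : Matrix (Fin N) (Fin N) ℝ} (hA : A ∈ doublyStochastic ℝ (Fin N)) (v : F) :
    mix A (fun _ => v) = fun _ => v := by
  ext i; simp [mix, ← Finset.sum_smul, sum_row_of_mem_doublyStochastic hA]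

lemma sum_mix {A : Matrix (Fin N) (Fin N) ℝ} (hA : A ∈ doublyStochastic ℝ (Fin N))
    (e : Fin N → F) : ∑ i, mix A e i = ∑ i, e i := by
  simp only [mix]
  rw [Finset.sum_comm]
  simp [← Finset.sum_smul, sum_col_of_mem_doublyStochastic hA]

lemma norm_mix_le {A : Matrix (Fin N) (Fin N) ℝ} (hA : A ∈ doublyStochastic ℝ (Fin N))
    (e : Fin N → F) : ‖mix A e‖ ≤ ‖e‖ := by
  refine (pi_norm_le_iff_of_nonneg (norm_nonneg _)).2 fun i => ?_
  calc ‖∑ j, A i j • e j‖ ≤ ∑ j, A i j * ‖e‖ := norm_sum_le_of_le _ fun j _ => by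
        rw [norm_smul, Real.norm_of_nonneg (nonneg_of_mem_doublyStochastic hA)]
        exact mul_le_mul_of_nonneg_left (norm_le_pi_norm e j) (nonneg_of_mem_doublyStochastic hA)
    _ = ‖e‖ := by rw [← Finset.sum_mul, sum_row_of_mem_doublyStochastic hA, one_mul]

/-- A positive doubly stochastic matrix contracts the families with zero sum. -/
lemma norm_mix_le_of_pos {A : Matrix (Fin N) (Fin N) ℝ} (hA : A ∈ doublyStochastic ℝ (Fin N))
    (hpos : ∀ i j, 0 < A i j) :
    ∃ r : ℝ, 0 ≤ r ∧ r < 1 ∧ ∀ e : Fin N → F, ∑ i, e i = 0 → ‖mix A e‖ ≤ r * ‖e‖ := by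
  rcases Nat.eq_zero_or_pos N with rfl | hN
  · refine ⟨0, le_rfl, one_pos, fun e _ => ?_⟩
    rw [Subsingleton.elim (mix A e) 0]; simp
  have : Nonempty (Fin N × Fin N) := ⟨(⟨0, hN⟩, ⟨0, hN⟩)⟩
  obtain ⟨q, hq⟩ := Finite.exists_min fun q : Fin N × Fin N => A q.1 q.2
  set δ := A q.1 q.2 with hδ
  have hδ0 : 0 < δ := hpos _ _
  have hsum : ∀ i, ∑ j, (A i j - δ) = 1 - N * δ := fun i => by
    rw [Finset.sum_sub_distrib, sum_row_of_mem_doublyStochastic hA]; simp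
  have hr0 : 0 ≤ 1 - N * δ := by
    rw [← hsum ⟨0, hN⟩]
    exact Finset.sum_nonneg fun j _ => sub_nonneg.2 (hq (_, j))
  have hN' : (0 : ℝ) < N := by exact_mod_cast hN
  refine ⟨1 - N * δ, hr0, by nlinarith [mul_pos hN' hδ0], fun e he => ?_⟩
  refine (pi_norm_le_iff_of_nonneg (by positivity)).2 fun i => ?_
  -- Subtracting the smallest entry δ from every weight costs nothing on zero-sum families and
  -- leaves nonnegative rows of sum 1 - Nδ.
  have h1 : mix A e i = ∑ j, (A i j - δ) • e j := by
    simp [mix, sub_smul, Finset.sum_sub_distrib, ← Finset.smul_sum, he]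
  rw [h1, ← hsum i, Finset.sum_mul]
  refine norm_sum_le_of_le _ fun j _ => ?_
  have : 0 ≤ A i j - δ := sub_nonneg.2 (hq (i, j))
  rw [norm_smul, Real.norm_of_nonneg this]
  exact mul_le_mul_of_nonneg_left (norm_le_pi_norm e j) this

/-- For primitive doubly stochastic weights there is an adapted norm, equivalent to the sup norm, in
which the consensus operator contracts the families with zero sum. -/
lemma exists_adapted_norm {A : Matrix (Fin N) (Fin N) ℝ} (hA : A ∈ doublyStochastic ℝ (Fin N))
    (hprim : A.IsPrimitive) :
    ∃ (ρ M : ℝ) (ν : (Fin N → F) → ℝ), ρ < 1 ∧ 1 ≤ M ∧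
      (∀ e, ‖e‖ ≤ ν e) ∧ (∀ e, ν e ≤ M * ‖e‖) ∧ (∀ e e', ν (e + e') ≤ ν e + ν e') ∧
      ∀ e, ∑ i, e i = 0 → ν (mix A e) ≤ ρ * ν e := by
  obtain ⟨p, hp, hpos⟩ := hprim.exists_pos_pow
  obtain ⟨r, hr0, hr1, hr⟩ := norm_mix_le_of_pos (F := F) (pow_mem hA p) hpos
  have hp' : (0 : ℝ) < p := by exact_mod_cast hp
  have hp1 : (1 : ℝ) ≤ p := by exact_mod_cast hp
  -- By Bernoulli's inequality ρ ^ p ≥ 1 - (1 - r)/2 ≥ r, so ρ is a per-step rate slow enough for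
  -- the p-step contraction.
  obtain ⟨ρ, hρ⟩ : ∃ ρ, ρ = 1 - (1 - r) / (2 * p) := ⟨_, rfl⟩
  have hx : (1 - r) / (2 * p) ≤ 1 / 2 := by rw [div_le_div_iff₀] <;> nlinarith
  have hx0 : 0 < (1 - r) / (2 * p) := by apply div_pos <;> linarith
  have hρ0 : 0 < ρ := by linarith
  have hρ1 : ρ < 1 := by linarith
  have hrp : r ≤ ρ ^ p := by
    have h := one_add_mul_le_pow (a := -((1 - r) / (2 * p))) (by linarith) p
    have h2 : (p : ℝ) * ((1 - r) / (2 * p)) = (1 - r) / 2 := by field_simp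
    rw [hρ, sub_eq_add_neg]
    linarith
  obtain ⟨k, rfl⟩ : ∃ k, p = k + 1 := ⟨p - 1, by omega⟩
  let ν : (Fin N → F) → ℝ := fun e => ∑ j ∈ Finset.range (k + 1), (ρ ^ j)⁻¹ * ‖mix (A ^ j) e‖
  have hc : ∀ j : ℕ, 0 < (ρ ^ j)⁻¹ := fun j => by positivity
  have hlow : ∀ e, ‖e‖ ≤ ν e := fun e => by
    have := Finset.single_le_sum (f := fun j => (ρ ^ j)⁻¹ * ‖mix (A ^ j) e‖)
      (fun j _ => mul_nonneg (hc j).le (norm_nonneg _)) (Finset.mem_range.2 (Nat.succ_pos k))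
    simpa [mix_one] using this
  refine ⟨ρ, ∑ j ∈ Finset.range (k + 1), (ρ ^ j)⁻¹, ν, hρ1, ?_, hlow, fun e => ?_, fun e e' => ?_,
    fun e he => ?_⟩
  · have := Finset.single_le_sum (f := fun j => (ρ ^ j)⁻¹)
      (fun j _ => (hc j).le) (Finset.mem_range.2 (Nat.succ_pos k))
    simpa using this
  · rw [Finset.sum_mul]
    exact Finset.sum_le_sum fun j _ =>
      mul_le_mul_of_nonneg_left (norm_mix_le (pow_mem hA j) e) (hc j).le
  · rw [← Finset.sum_add_distrib]
    refine Finset.sum_le_sum fun j _ => ?_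
    rw [mix_add, ← mul_add]
    exact mul_le_mul_of_nonneg_left (norm_add_le _ _) (hc j).le
  · simp only [ν]
    have h1 : ∀ j, (ρ ^ j)⁻¹ * ‖mix (A ^ j) (mix A e)‖
        = ρ * ((ρ ^ (j + 1))⁻¹ * ‖mix (A ^ (j + 1)) e‖) := fun j => by
      rw [mix_mix, ← pow_succ, pow_succ ρ]; field_simp
    rw [Finset.sum_congr rfl fun j _ => h1 j, ← Finset.mul_sum]
    refine mul_le_mul_of_nonneg_left ?_ hρ0.le
    -- Applying `A` shifts the weighted sum by one index. Only the new top term differs, and the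
    -- contraction of the positive power bounds it by the old term of index 0.
    rw [Finset.sum_range_succ, Finset.sum_range_succ' _ k]
    refine add_le_add le_rfl ?_
    calc (ρ ^ (k + 1))⁻¹ * ‖mix (A ^ (k + 1)) e‖ ≤ (ρ ^ (k + 1))⁻¹ * (ρ ^ (k + 1) * ‖e‖) := by
          gcongr
          exact (hr e he).trans (by gcongr)
      _ = (ρ ^ 0)⁻¹ * ‖mix (A ^ 0) e‖ := by rw [pow_zero, pow_zero, mix_one]; field_simp

end Consensus

/-! ### Strong convexity and gradient steps -/

section Convexity
open Filter Topology
variable {E : Type*} [NormedAddCommGroup E] [InnerProductSpace ℝ E]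

/-- First-order characterization of strong convexity, at one point. -/
lemma StrongConvexOn.le_inner_gradient [CompleteSpace E] {s : Set E} {m : ℝ} {f : E → ℝ}
    (hf : StrongConvexOn s m f) {x y : E} (hx : x ∈ s) (hy : y ∈ s) (hd : DifferentiableAt ℝ f x) :
    f x + inner ℝ (gradient f x) (y - x) + m / 2 * ‖x - y‖ ^ 2 ≤ f y := by
  have hder : HasDerivAt (fun t : ℝ => f (x + t • (y - x))) (fderiv ℝ f x (y - x)) 0 := by
    have hg : HasDerivAt (fun t : ℝ => x + t • (y - x)) (y - x) 0 := by
      simpa using ((hasDerivAt_id (0 : ℝ)).smul_const (y - x)).const_add x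
    have hF : HasFDerivAt f (fderiv ℝ f x) (x + (0 : ℝ) • (y - x)) := by
      simpa using hd.hasFDerivAt
    exact hF.comp_hasDerivAt (0 : ℝ) hg
  have hlim := hder.tendsto_slope_zero_right
  have hlim2 : Tendsto (fun t : ℝ => f y - f x - (1 - t) * (m / 2 * ‖x - y‖ ^ 2)) (𝓝[>] 0)
      (𝓝 (f y - f x - (1 - 0) * (m / 2 * ‖x - y‖ ^ 2))) := by
    refine Tendsto.mono_left (Continuous.tendsto ?_ 0) nhdsWithin_le_nhds
    fun_prop
  -- The chord inequality of strong convexity, divided by t, is passed to the limit t → 0+.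
  have hle := le_of_tendsto_of_tendsto hlim hlim2 ?_
  · rw [inner_gradient_left]; linarith
  · filter_upwards [self_mem_nhdsWithin, mem_nhdsWithin_of_mem_nhds (Iio_mem_nhds one_pos)]
      with t (ht0 : 0 < t) (ht1 : t < 1)
    have h := hf.2 hx hy (sub_nonneg.2 ht1.le) ht0.le (by ring)
    have he : (1 - t) • x + t • y = x + t • (y - x) := by module
    rw [he] at h
    simp only [smul_eq_mul] at h
    simp only [zero_add, zero_smul, add_zero, smul_eq_mul]
    rw [inv_mul_le_iff₀ ht0]
    nlinarith

/-- Restricted strong monotonicity of the gradient at a minimizer. -/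
lemma StrongConvexOn.le_inner_gradient_of_isMinOn [CompleteSpace E] {s : Set E} {m : ℝ} {f : E → ℝ}
    (hf : StrongConvexOn s m f) {x y : E} (hx : x ∈ s) (hy : y ∈ s) (hd : DifferentiableAt ℝ f x)
    (hmin : IsMinOn f s y) : m / 2 * ‖x - y‖ ^ 2 ≤ inner ℝ (gradient f x) (x - y) := by
  have h1 := StrongConvexOn.le_inner_gradient hf hx hy hd
  have h2 : f y ≤ f x := hmin hx
  rw [← neg_sub x y, inner_neg_right] at h1
  linarith

/-- Strong monotonicity towards the center of a ball persists on a slightly larger ball. -/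
lemma le_inner_of_mem_enlarged_ball {G : E → E} {L m r η : ℝ} {y : E} (hr : 0 < r) (hm : 0 ≤ m)
    (hη1 : η ≤ 1) (hη : L * η ≤ m / 2) (hL : 0 ≤ L)
    (hG : ∀ t t', ‖G t - G t'‖ ≤ L * ‖t - t'‖)
    (hmono : ∀ t ∈ Metric.closedBall y r, m * ‖t - y‖ ^ 2 ≤ inner ℝ (G t) (t - y))
    {t : E} (ht : ‖t - y‖ ≤ (1 + η) * r) : m / 4 * ‖t - y‖ ^ 2 ≤ inner ℝ (G t) (t - y) := by
  rcases le_or_gt ‖t - y‖ r with h | h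
  · have := hmono t (by rwa [Metric.mem_closedBall, dist_eq_norm])
    nlinarith [mul_nonneg hm (sq_nonneg ‖t - y‖)]
  obtain ⟨D, hD⟩ : ∃ D, D = ‖t - y‖ := ⟨_, rfl⟩
  have hD0 : 0 < D := by rw [hD]; linarith
  rw [← hD] at h ht ⊢
  -- The radial projection of `t` onto the sphere of radius r. Moving back to `t` changes G by at
  -- most L η r, half of the available monotonicity; the other factor 1/2 comes from D ≤ 2r.
  set t' : E := y + (r / D) • (t - y) with ht'
  have e1 : t' - y = (r / D) • (t - y) := by rw [ht']; abel
  have n1 : ‖t' - y‖ = r := by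
    rw [e1, norm_smul, ← hD, Real.norm_of_nonneg (by positivity)]; field_simp
  have e2 : t - t' = (1 - r / D) • (t - y) := by rw [ht']; module
  have hrD : r / D ≤ 1 := by rw [div_le_one hD0]; exact h.le
  have n2 : ‖t - t'‖ = D - r := by
    rw [e2, norm_smul, ← hD, Real.norm_of_nonneg (by linarith)]; field_simp
  have h1 := hmono t' (by rw [Metric.mem_closedBall, dist_eq_norm, n1])
  have h2 : |inner ℝ (G t - G t') (t' - y)| ≤ L * (D - r) * r := by
    refine (abs_real_inner_le_norm _ _).trans ?_
    rw [n1]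
    exact mul_le_mul_of_nonneg_right (n2 ▸ hG t t') hr.le
  have h3 : m / 2 * r ^ 2 ≤ inner ℝ (G t) (t' - y) := by
    rw [inner_sub_left] at h2
    rw [n1] at h1
    have h4 := (abs_le.1 h2).1
    have h5 : L * (D - r) ≤ m / 2 * r := by
      have : D - r ≤ η * r := by linarith
      calc L * (D - r) ≤ L * (η * r) := by gcongr
        _ = L * η * r := by ring
        _ ≤ m / 2 * r := by gcongr
    nlinarith
  rw [e1, real_inner_smul_right] at h3
  have h6 : inner ℝ (G t) (t - y) = D / r * (r / D * inner ℝ (G t) (t - y)) := by field_simp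
  rw [h6]
  calc m / 4 * D ^ 2 = D / r * (m / 4 * (r * D)) := by field_simp
    _ ≤ D / r * (m / 2 * r ^ 2) := by
        have : D ≤ 2 * r := by nlinarith
        gcongr ?_ * ?_
        nlinarith [mul_nonneg hm hr.le, mul_le_mul_of_nonneg_left this (mul_nonneg hm hr.le)]
    _ ≤ _ := by gcongr

/-- A small step along a strongly monotone field of linear growth contracts. -/
lemma norm_sub_smul_sub_le {v t y : E} {m L γ : ℝ} (hγ : 0 ≤ γ)
    (hmono : m * ‖t - y‖ ^ 2 ≤ inner ℝ v (t - y)) (hv : ‖v‖ ≤ L * ‖t - y‖)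
    (h1 : γ * L ^ 2 ≤ m) (h2 : γ * m ≤ 2) :
    ‖t - γ • v - y‖ ≤ (1 - γ * (m / 2)) * ‖t - y‖ := by
  have h0 : 0 ≤ 1 - γ * (m / 2) := by linarith
  refine abs_le_of_sq_le_sq' ?_ (by positivity) |>.2
  have e : t - γ • v - y = (t - y) - γ • v := by abel
  rw [e, norm_sub_sq_real, real_inner_smul_right, real_inner_comm, norm_smul,
    Real.norm_of_nonneg hγ]
  have hv2 : ‖v‖ ^ 2 ≤ L ^ 2 * ‖t - y‖ ^ 2 := by
    rw [← mul_pow]; exact pow_le_pow_left₀ (norm_nonneg _) hv 2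
  -- The squared factor is at most 1 - 2γm + γ²L² ≤ 1 - γm ≤ (1 - γm/2)².
  have a1 := mul_le_mul_of_nonneg_left hmono hγ
  have a2 := mul_le_mul_of_nonneg_left hv2 (sq_nonneg γ)
  have a3 := mul_le_mul_of_nonneg_right h1 (mul_nonneg hγ (sq_nonneg ‖t - y‖))
  have a4 : 0 ≤ (γ * (m / 2)) ^ 2 * ‖t - y‖ ^ 2 := by positivity
  nlinarith

end Convexity

/-! ### Elementary norm comparisons -/

section Norms

lemma sqrt_sq_add_sq_add_sq_le {u v t : ℝ} (hu : 0 ≤ u) (hv : 0 ≤ v) (ht : 0 ≤ t) :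
    Real.sqrt (u ^ 2 + v ^ 2 + t ^ 2) ≤ u + v + t := by
  rw [Real.sqrt_le_left (by positivity)]
  nlinarith [mul_nonneg hu hv, mul_nonneg hu ht, mul_nonneg hv ht]

lemma Lip3.norm_sub_le {a b c e : ℕ} {C : ℝ} {G : Vec a → Vec b → Vec c → Vec e} (h : Lip3 C G)
    (hC : 0 ≤ C) (u u' : Vec a) (v v' : Vec b) (t t' : Vec c) :
    ‖G u v t - G u' v' t'‖ ≤ C * (‖u - u'‖ + ‖v - v'‖ + ‖t - t'‖) :=
  (h u u' v v' t t').trans (mul_le_mul_of_nonneg_left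
    (sqrt_sq_add_sq_add_sq_le (norm_nonneg _) (norm_nonneg _) (norm_nonneg _)) hC)

lemma Stack.norm_le {N : ℕ} {b : Fin N → ℕ} (x : Stack b) {R : ℝ} (hR : 0 ≤ R)
    (h : ∀ i, ‖x i‖ ≤ R) : ‖x‖ ≤ N * R := by
  refine abs_le_of_sq_le_sq' ?_ (by positivity) |>.2
  rw [PiLp.norm_sq_eq_of_L2]
  calc ∑ i, ‖x i‖ ^ 2 ≤ ∑ _i : Fin N, R ^ 2 :=
        Finset.sum_le_sum fun i _ => pow_le_pow_left₀ (norm_nonneg _) (h i) 2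
    _ = N * R ^ 2 := by simp
    _ ≤ (N : ℝ) ^ 2 * R ^ 2 := by
        gcongr
        exact_mod_cast Nat.le_self_pow two_ne_zero N
    _ = _ := by ring

lemma norm_avg_le {N : ℕ} {F : Type*} [NormedAddCommGroup F] [NormedSpace ℝ F] (v : Fin N → F)
    {R : ℝ} (hR : 0 ≤ R) (h : ∀ i, ‖v i‖ ≤ R) : ‖(1 / (N : ℝ)) • ∑ i, v i‖ ≤ R := by
  rcases Nat.eq_zero_or_pos N with rfl | hN
  · simpa using hR
  have hN' : (0 : ℝ) < N := by exact_mod_cast hN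
  rw [norm_smul, Real.norm_of_nonneg (by positivity)]
  calc 1 / (N : ℝ) * ‖∑ i, v i‖ ≤ 1 / (N : ℝ) * ∑ _i : Fin N, R := by
        gcongr; exact norm_sum_le_of_le _ fun i _ => h i
    _ = R := by simp; field_simp

end Norms

/-! ### The gradient of the aggregative cost -/

namespace Problem
variable {N : ℕ} {n : Fin N → ℕ} {d : ℕ} {P : Problem N n d} {μf L Lx Lσ Lφ : ℝ}

lemma Regular.norm_gradφ_le (h : P.Regular μf L Lx Lσ Lφ) (i : Fin N) (u : Vec (n i)) (v : Vec d) :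
    ‖P.gradφ i u v‖ ≤ Lφ * ‖v‖ := by
  refine (ContinuousLinearMap.le_opNorm _ _).trans (mul_le_mul_of_nonneg_right ?_ (norm_nonneg _))
  rw [gradφ, LinearIsometryEquiv.norm_map]
  have : LipschitzWith Lφ.toNNReal (P.φ i) := LipschitzWith.of_dist_le_mul fun u v => by
    rw [dist_eq_norm, dist_eq_norm, Real.coe_toNNReal _ h.Lφ_pos.le]
    exact h.lip_φ i u v
  have := norm_fderiv_le_of_lipschitz ℝ this (x₀ := u)
  rwa [Real.coe_toNNReal _ h.Lφ_pos.le] at this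

/-- The blocks of the gradient of the global cost. -/
lemma Regular.gradient_cost_apply (h : P.Regular μf L Lx Lσ Lφ) (x : Stack n) (i : Fin N) :
    gradient P.cost x i = P.grad₁ i (x i) (P.agg x)
      + P.gradφ i (x i) ((1 / (N : ℝ)) • ∑ j, P.grad₂ j (x j) (P.agg x)) := by
  have hx : ∀ i, HasFDerivAt (fun x : Stack n => x i) (PiLp.proj 2 (fun i => Vec (n i)) i) x :=
    fun i => PiLp.hasFDerivAt_apply (𝕜 := ℝ) 2 x i
  have hφ : ∀ i, HasFDerivAt (fun x : Stack n => P.φ i (x i))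
      ((fderiv ℝ (P.φ i) (x i)).comp (PiLp.proj (𝕜 := ℝ) 2 (fun i => Vec (n i)) i)) x :=
    fun i => (h.diff_φ i (x i)).hasFDerivAt.comp x (hx i)
  have hagg : HasFDerivAt P.agg ((1 / (N : ℝ)) • ∑ i, (fderiv ℝ (P.φ i) (x i)).comp
      (PiLp.proj (𝕜 := ℝ) 2 (fun i => Vec (n i)) i)) x :=
    HasFDerivAt.const_smul (HasFDerivAt.fun_sum (u := Finset.univ) fun i _ => hφ i) (1 / (N : ℝ))
  have hf : ∀ j, HasFDerivAt (fun x : Stack n => P.f j (x j) (P.agg x)) _ x := fun j =>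
    (h.diff_f j (x j, P.agg x)).hasFDerivAt.comp (f := fun x : Stack n => (x j, P.agg x)) x
      ((hx j).prodMk hagg)
  have hcost : HasFDerivAt P.cost _ x := HasFDerivAt.fun_sum fun j _ => hf j
  have h1 : ∀ j (v : Vec (n j)), fderiv ℝ (fun q : Vec (n j) × Vec d => P.f j q.1 q.2)
      (x j, P.agg x) (v, 0) = inner ℝ (P.grad₁ j (x j) (P.agg x)) v := fun j v => by
    rw [grad₁, inner_gradient_left]
    have := (h.diff_f j (x j, P.agg x)).hasFDerivAt.comp (f := fun s => (s, P.agg x)) (x j)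
      (hasFDerivAt_prodMk_left (𝕜 := ℝ) (x j) (P.agg x))
    have := this.fderiv
    simp only [Function.comp_def] at this
    rw [this]; simp
  have h2 : ∀ j (v : Vec d), fderiv ℝ (fun q : Vec (n j) × Vec d => P.f j q.1 q.2)
      (x j, P.agg x) (0, v) = inner ℝ (P.grad₂ j (x j) (P.agg x)) v := fun j v => by
    rw [grad₂, inner_gradient_left]
    have := (h.diff_f j (x j, P.agg x)).hasFDerivAt.comp (f := fun s => (x j, s)) (P.agg x)
      (hasFDerivAt_prodMk_right (𝕜 := ℝ) (x j) (P.agg x))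
    have := this.fderiv
    simp only [Function.comp_def] at this
    rw [this]; simp
  have hall : gradient P.cost x = WithLp.toLp 2 fun i => P.grad₁ i (x i) (P.agg x)
      + P.gradφ i (x i) ((1 / (N : ℝ)) • ∑ j, P.grad₂ j (x j) (P.agg x)) := by
    refine ext_inner_right ℝ fun v => ?_
    rw [inner_gradient_left, hcost.fderiv, PiLp.inner_apply]
    simp only [_root_.sum_apply, ContinuousLinearMap.comp_apply,
      ContinuousLinearMap.prod_apply, PiLp.proj_apply, _root_.smul_apply]
    have h3 : ∀ j (u : Vec (n j)) (w : Vec d),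
        fderiv ℝ (fun q : Vec (n j) × Vec d => P.f j q.1 q.2) (x j, P.agg x) (u, w)
        = inner ℝ (P.grad₁ j (x j) (P.agg x)) u + inner ℝ (P.grad₂ j (x j) (P.agg x)) w :=
      fun j u w => by
        rw [← h1, ← h2, ← map_add]; simp
    simp only [h3, inner_add_left, Finset.sum_add_distrib, gradφ,
      ContinuousLinearMap.adjoint_inner_left, ← sum_inner, ← inner_sum, real_inner_smul_left,
      real_inner_smul_right, ← Finset.mul_sum]
  rw [hall]

end Problem

/-! ### Averaging of the learning dynamics -/

namespace Learner
variable {N : ℕ} {n : Fin N → ℕ} {d : ℕ} {m : Fin N → ℕ} (Q : Learner N n d m)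

/-- The sample gradient with the dither of time `τ`. -/
def ditherGrad (i : Fin N) (τ : ℕ) (u : Vec (n i)) (v : Vec d) (t : Vec (m i)) : Vec (m i) :=
  Q.gradℓ i (u + Q.dx i τ) (v + Q.dσ i τ) t

/-- The sample gradient averaged over one period of the dithers. -/
def avgGrad (K : ℕ) (i : Fin N) (u : Vec (n i)) (v : Vec d) (t : Vec (m i)) : Vec (m i) :=
  (1 / (K : ℝ)) • ∑ τ : Fin K, Q.ditherGrad i τ u v t

/-- The averaging corrector: the partial sums over a period of the zero-mean part of the sample
gradients. -/
def corrector (K : ℕ) (i : Fin N) (k : ℕ) (u : Vec (n i)) (v : Vec d) (t : Vec (m i)) :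
    Vec (m i) :=
  ∑ τ ∈ Finset.range (k % K), (Q.ditherGrad i τ u v t - Q.avgGrad K i u v t)

variable {Q} {P : Problem N n d} {K : ℕ} {μℓ Lℓ ε : ℝ} {θstar : Stack m} {rbar : Fin N → ℝ}

namespace GoodLearning

lemma ditherGrad_mod (h : Q.GoodLearning K μℓ Lℓ θstar rbar) (i : Fin N) (τ : ℕ) :
    Q.ditherGrad i (τ % K) = Q.ditherGrad i τ := by
  have hp : Function.Periodic (Q.ditherGrad i) K := fun τ => by
    ext1 u; ext1 v; ext1 t
    rw [ditherGrad, ditherGrad, h.periodic_dx, h.periodic_dσ]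
  exact hp.map_mod_nat τ

/-- Reconciles the period 1, …, K of the averaged loss with the period 0, …, K - 1 of the corrector.
-/
lemma sum_Icc_ditherGrad (h : Q.GoodLearning K μℓ Lℓ θstar rbar) (i : Fin N) (u : Vec (n i))
    (v : Vec d) (t : Vec (m i)) :
    ∑ τ ∈ Finset.Icc 1 K, Q.ditherGrad i τ u v t = ∑ τ ∈ Finset.range K, Q.ditherGrad i τ u v t := by
  have h0 : Q.ditherGrad i K = Q.ditherGrad i 0 := by
    rw [← h.ditherGrad_mod i K, Nat.mod_self]
  have h1 := Finset.sum_range_succ (fun τ => Q.ditherGrad i τ u v t) K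
  rw [Finset.sum_range_succ', h0] at h1
  rw [← add_right_cancel h1, Finset.range_eq_Ico,
    Finset.sum_Ico_add' (fun τ => Q.ditherGrad i τ u v t) 0 K 1, zero_add,
    Finset.Ico_add_one_right_eq_Icc]

lemma corrector_succ (h : Q.GoodLearning K μℓ Lℓ θstar rbar) (hK : 0 < K) (i : Fin N) (k : ℕ)
    (u : Vec (n i)) (v : Vec d) (t : Vec (m i)) :
    Q.corrector K i (k + 1) u v t
      = Q.corrector K i k u v t + (Q.ditherGrad i k u v t - Q.avgGrad K i u v t) := by
  have hlt := Nat.mod_lt k hK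
  have h1 : Q.corrector K i k u v t + (Q.ditherGrad i k u v t - Q.avgGrad K i u v t)
      = ∑ τ ∈ Finset.range (k % K + 1), (Q.ditherGrad i τ u v t - Q.avgGrad K i u v t) := by
    rw [Finset.sum_range_succ, h.ditherGrad_mod, corrector]
  rw [h1, corrector]
  rcases Nat.lt_or_ge (k % K + 1) K with hc | hc
  · rw [← Nat.mod_add_mod, Nat.mod_eq_of_lt hc]
  · have hc' : k % K + 1 = K := by omega
    have h2 : (k + 1) % K = 0 := by rw [← Nat.mod_add_mod, hc', Nat.mod_self]
    have hK' : (K : ℝ) ≠ 0 := by positivity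
    -- At the end of a period the fluctuations have summed to zero, which is consistent with the
    -- reset of the corrector to the empty sum.
    have h3 : ∑ τ ∈ Finset.range K, (Q.ditherGrad i τ u v t - Q.avgGrad K i u v t) = 0 := by
      rw [Finset.sum_sub_distrib, Finset.sum_const, avgGrad, ← Finset.sum_range
        (fun τ => Q.ditherGrad i τ u v t), Finset.card_range, ← Nat.cast_smul_eq_nsmul ℝ, smul_smul,
        mul_one_div_cancel hK', one_smul, sub_self]
    rw [h2, hc', h3, Finset.sum_range_zero]

lemma gradient_avgLoss (h : Q.GoodLearning K μℓ Lℓ θstar rbar) (i : Fin N) (u : Vec (n i))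
    (v : Vec d) (t : Vec (m i)) :
    DifferentiableAt ℝ (Q.avgLoss K i u v) t ∧
      gradient (Q.avgLoss K i u v) t = Q.avgGrad K i u v t := by
  have h1 : ∀ τ, HasFDerivAt (Q.ℓ i (u + Q.dx i τ) (v + Q.dσ i τ))
      (fderiv ℝ (Q.ℓ i (u + Q.dx i τ) (v + Q.dσ i τ)) t) t :=
    fun τ => (h.diff_ℓ i _ _ t).hasFDerivAt
  have h2 : HasFDerivAt (Q.avgLoss K i u v) _ t :=
    HasFDerivAt.const_mul (HasFDerivAt.fun_sum (u := Finset.Icc 1 K) fun τ _ => h1 τ) (1 / (K : ℝ))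
  refine ⟨h2.differentiableAt, ext_inner_right ℝ fun w => ?_⟩
  rw [inner_gradient_left, h2.fderiv, avgGrad, ← Finset.sum_range
    (fun τ => Q.ditherGrad i τ u v t), ← h.sum_Icc_ditherGrad, real_inner_smul_left, sum_inner]
  simp [ditherGrad, gradℓ, inner_gradient_left]

/-- The ball has positive radius, so its center is an interior minimizer. -/
lemma avgGrad_θstar (h : Q.GoodLearning K μℓ Lℓ θstar rbar) (i : Fin N) (u : Vec (n i))
    (v : Vec d) : Q.avgGrad K i u v (θstar i) = 0 := by
  rw [← (h.gradient_avgLoss i u v _).2]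
  have h1 : IsLocalMin (Q.avgLoss K i u v) (θstar i) :=
    (h.isMin i u v).isLocalMin (Metric.closedBall_mem_nhds _ (h.rbar_pos i))
  rw [gradient, h1.fderiv_eq_zero, map_zero]

lemma norm_ditherGrad_sub_le (h : Q.GoodLearning K μℓ Lℓ θstar rbar) (hL : 0 ≤ Lℓ) (i : Fin N)
    (τ : ℕ) (u u' : Vec (n i)) (v v' : Vec d) (t t' : Vec (m i)) :
    ‖Q.ditherGrad i τ u v t - Q.ditherGrad i τ u' v' t'‖
      ≤ Lℓ * (‖u - u'‖ + ‖v - v'‖ + ‖t - t'‖) := by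
  refine ((h.lip_gradℓ i).norm_sub_le hL _ _ _ _ _ _).trans_eq ?_
  rw [add_sub_add_right_eq_sub, add_sub_add_right_eq_sub]

lemma norm_avgGrad_sub_le (h : Q.GoodLearning K μℓ Lℓ θstar rbar) (hL : 0 ≤ Lℓ) (i : Fin N)
    (u u' : Vec (n i)) (v v' : Vec d) (t t' : Vec (m i)) :
    ‖Q.avgGrad K i u v t - Q.avgGrad K i u' v' t'‖ ≤ Lℓ * (‖u - u'‖ + ‖v - v'‖ + ‖t - t'‖) := by
  rw [avgGrad, avgGrad, ← smul_sub, ← Finset.sum_sub_distrib]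
  exact norm_avg_le _ (by positivity) fun τ => h.norm_ditherGrad_sub_le hL i τ u u' v v' t t'

lemma norm_corrector_sub_le (h : Q.GoodLearning K μℓ Lℓ θstar rbar) (hL : 0 ≤ Lℓ) (hK : 0 < K)
    (i : Fin N) (k : ℕ) (u u' : Vec (n i)) (v v' : Vec d) (t t' : Vec (m i)) :
    ‖Q.corrector K i k u v t - Q.corrector K i k u' v' t'‖
      ≤ 2 * K * Lℓ * (‖u - u'‖ + ‖v - v'‖ + ‖t - t'‖) := by
  rw [corrector, corrector, ← Finset.sum_sub_distrib]
  have hle : ((k % K : ℕ) : ℝ) ≤ K := by exact_mod_cast (Nat.mod_lt k hK).le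
  calc _ ≤ ∑ _τ ∈ Finset.range (k % K), 2 * (Lℓ * (‖u - u'‖ + ‖v - v'‖ + ‖t - t'‖)) :=
        norm_sum_le_of_le _ fun τ _ => by
          rw [sub_sub_sub_comm, two_mul]
          exact (norm_sub_le _ _).trans (add_le_add (h.norm_ditherGrad_sub_le hL i τ u u' v v' t t')
            (h.norm_avgGrad_sub_le hL i u u' v v' t t'))
    _ = (k % K : ℕ) * (2 * (Lℓ * (‖u - u'‖ + ‖v - v'‖ + ‖t - t'‖))) := by simp
    _ ≤ K * (2 * (Lℓ * (‖u - u'‖ + ‖v - v'‖ + ‖t - t'‖))) := by gcongr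
    _ = _ := by ring

lemma norm_corrector_le {i : Fin N} (hK : 0 < K) {u : Vec (n i)} {v : Vec d} {t : Vec (m i)} {R : ℝ}
    (hR : 0 ≤ R) (hg : ∀ τ, ‖Q.ditherGrad i τ u v t‖ ≤ R) (k : ℕ) :
    ‖Q.corrector K i k u v t‖ ≤ 2 * K * R := by
  have hle : ((k % K : ℕ) : ℝ) ≤ K := by exact_mod_cast (Nat.mod_lt k hK).le
  calc _ ≤ ∑ _τ ∈ Finset.range (k % K), 2 * R := norm_sum_le_of_le _ fun τ _ => by
          rw [two_mul]
          exact (norm_sub_le _ _).trans (add_le_add (hg τ) (norm_avg_le _ hR fun τ => hg τ))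
    _ = (k % K : ℕ) * (2 * R) := by simp
    _ ≤ K * (2 * R) := by gcongr
    _ = _ := by ring

lemma le_inner_avgGrad (h : Q.GoodLearning K μℓ Lℓ θstar rbar) (hμ : 0 ≤ μℓ) (hL : 0 ≤ Lℓ) {η : ℝ}
    (hη1 : η ≤ 1) (hη : Lℓ * η ≤ μℓ / 4) (i : Fin N) (u : Vec (n i)) (v : Vec d) {t : Vec (m i)}
    (ht : ‖t - θstar i‖ ≤ (1 + η) * rbar i) :
    μℓ / 8 * ‖t - θstar i‖ ^ 2 ≤ inner ℝ (Q.avgGrad K i u v t) (t - θstar i) := by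
  have := le_inner_of_mem_enlarged_ball (G := Q.avgGrad K i u v) (m := μℓ / 2) (h.rbar_pos i)
    (by positivity) hη1 (by linarith) hL
    (fun t t' => by simpa using h.norm_avgGrad_sub_le hL i u u v v t t') (fun t ht => by
      rw [← (h.gradient_avgLoss i u v t).2]
      exact StrongConvexOn.le_inner_gradient_of_isMinOn (h.strongConvex i u v) ht
        (Metric.mem_closedBall_self (h.rbar_pos i).le) (h.gradient_avgLoss i u v t).1
        (h.isMin i u v)) ht
  linarith

/-- One step of the learning dynamics in the averaged coordinate `t + γ • corrector`. -/
lemma averaged_step (h : Q.GoodLearning K μℓ Lℓ θstar rbar) (hK : 0 < K) (hμ : 0 ≤ μℓ)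
    (hL : 0 ≤ Lℓ) {η γ R : ℝ} (hη1 : η ≤ 1) (hη : Lℓ * η ≤ μℓ / 4) (hγ : 0 ≤ γ)
    (hγ1 : γ * Lℓ ^ 2 ≤ μℓ / 8) (hγ2 : γ * (μℓ / 8) ≤ 2) (i : Fin N) (k : ℕ) (u u' : Vec (n i))
    (v v' : Vec d) (t : Vec (m i)) (hR : 0 ≤ R) (hg : ∀ τ, ‖Q.ditherGrad i τ u v t‖ ≤ R)
    (hy : ‖t + γ • Q.corrector K i k u v t - θstar i‖ ≤ (1 + η) * rbar i) :
    ‖t - γ • Q.ditherGrad i k u v t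
        + γ • Q.corrector K i (k + 1) u' v' (t - γ • Q.ditherGrad i k u v t) - θstar i‖
      ≤ (1 - γ * (μℓ / 16)) * ‖t + γ • Q.corrector K i k u v t - θstar i‖
        + γ * (2 * K * Lℓ) * (‖u' - u‖ + ‖v' - v‖ + ‖t - γ • Q.ditherGrad i k u v t - t‖)
        + γ ^ 2 * (2 * K * Lℓ) * R := by
  set t' := t - γ • Q.ditherGrad i k u v t with ht'
  set y := t + γ • Q.corrector K i k u v t with hy'
  -- At the frozen state the corrector increment replaces the sample gradient by the averaged one.
  -- What remains is a contracting step from `y`, the cost of evaluating at `y` rather than `t`, of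
  -- order γ² since y - t is γ times the corrector, and the motion of the corrector's arguments.
  have e : t' + γ • Q.corrector K i (k + 1) u' v' t' - θstar i
      = (y - γ • Q.avgGrad K i u v y - θstar i)
        + γ • (Q.avgGrad K i u v y - Q.avgGrad K i u v t)
        + γ • (Q.corrector K i (k + 1) u' v' t' - Q.corrector K i (k + 1) u v t) := by
    rw [h.corrector_succ hK i k u v t]
    generalize Q.corrector K i (k + 1) u' v' t' = A
    rw [ht']
    generalize Q.avgGrad K i u v y = B
    rw [hy']
    module
  have h1 := norm_sub_smul_sub_le (y := θstar i) hγ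
    (h.le_inner_avgGrad hμ hL hη1 hη i u v hy) (by
      simpa [h.avgGrad_θstar] using h.norm_avgGrad_sub_le hL i u u v v y (θstar i)) hγ1 hγ2
  have h2 : ‖γ • (Q.avgGrad K i u v y - Q.avgGrad K i u v t)‖ ≤ γ ^ 2 * (2 * K * Lℓ) * R := by
    rw [norm_smul, Real.norm_of_nonneg hγ]
    have e1 : ‖y - t‖ = γ * ‖Q.corrector K i k u v t‖ := by
      rw [hy', add_sub_cancel_left, norm_smul, Real.norm_of_nonneg hγ]
    have h3 := h.norm_avgGrad_sub_le hL i u u v v y t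
    rw [sub_self, sub_self, norm_zero, norm_zero, zero_add, zero_add, e1] at h3
    calc _ ≤ γ * (Lℓ * (γ * (2 * K * R))) := by
          refine mul_le_mul_of_nonneg_left (h3.trans ?_) hγ
          gcongr
          exact norm_corrector_le hK hR hg k
      _ = _ := by ring
  have h3 : ‖γ • (Q.corrector K i (k + 1) u' v' t' - Q.corrector K i (k + 1) u v t)‖
      ≤ γ * (2 * K * Lℓ) * (‖u' - u‖ + ‖v' - v‖ + ‖t' - t‖) := by
    rw [norm_smul, Real.norm_of_nonneg hγ, mul_assoc]
    exact mul_le_mul_of_nonneg_left (h.norm_corrector_sub_le hL hK _ _ _ _ _ _ _ _) hγ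
  rw [e]
  have := norm_add₃_le (a := y - γ • Q.avgGrad K i u v y - θstar i)
    (b := γ • (Q.avgGrad K i u v y - Q.avgGrad K i u v t))
    (c := γ • (Q.corrector K i (k + 1) u' v' t' - Q.corrector K i (k + 1) u v t))
  linarith

/-- The sample gradients are controlled by the consensus and learning errors and the accuracy. -/
lemma norm_ditherGrad_le (h : Q.GoodLearning K μℓ Lℓ θstar rbar) (hK : 0 < K) (hL : 0 ≤ Lℓ)
    (hrec : Q.Reconstructs P K θstar ε) (i : Fin N) (τ : ℕ) (x : Stack n) (v : Vec d)
    (t : Vec (m i)) :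
    ‖Q.ditherGrad i τ (x i) v t‖ ≤ ε + Lℓ * (‖v - P.agg x‖ + ‖t - θstar i‖) := by
  -- Accuracy is assumed only at the times 1, …, K; the residue 0 is represented by K.
  obtain ⟨k, hk, hkτ⟩ : ∃ k ∈ Finset.Icc 1 K, Q.ditherGrad i τ = Q.ditherGrad i k := by
    rw [← h.ditherGrad_mod]
    rcases Nat.eq_zero_or_pos (τ % K) with h0 | h0
    · refine ⟨K, Finset.mem_Icc.2 ⟨hK, le_rfl⟩, ?_⟩
      rw [h0, ← h.ditherGrad_mod i K, Nat.mod_self]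
    · exact ⟨_, Finset.mem_Icc.2 ⟨h0, (Nat.mod_lt _ hK).le⟩, rfl⟩
  obtain ⟨p₁, p₂, pℓ, -, -, -, hp⟩ := hrec i
  obtain ⟨-, -, h1, -, -, h2⟩ := hp x k hk
  have h3 := h.norm_ditherGrad_sub_le hL i k (x i) (x i) v (P.agg x) t (θstar i)
  rw [sub_self, norm_zero, zero_add] at h3
  rw [hkτ]
  have h4 : ‖Q.ditherGrad i k (x i) (P.agg x) (θstar i)‖ ≤ ε := by rwa [ditherGrad, h1]
  have := norm_le_norm_add_norm_sub' (Q.ditherGrad i k (x i) v t)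
    (Q.ditherGrad i k (x i) (P.agg x) (θstar i))
  linarith

end GoodLearning

lemma Reconstructs.norm_grad₁_sub_le {Lhx Lhσ : ℝ} (hrec : Q.Reconstructs P K θstar ε) (hK : 0 < K)
    (hs : Q.SmoothProxies Lhx Lhσ) (hL : 0 ≤ Lhx) (i : Fin N) (x : Stack n) (v : Vec d)
    (t : Vec (m i)) :
    ‖Q.grad₁ i (x i) v t - P.grad₁ i (x i) (P.agg x)‖
      ≤ ε + Lhx * (‖v - P.agg x‖ + ‖t - θstar i‖) := by
  obtain ⟨p₁, p₂, pℓ, -, -, -, hp⟩ := hrec i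
  obtain ⟨h1, -, -, h2, -, -⟩ := hp x 1 (Finset.mem_Icc.2 ⟨le_rfl, hK⟩)
  have h3 := (hs.lip_grad₁ i).norm_sub_le hL (x i) (x i) v (P.agg x) t (θstar i)
  rw [sub_self, norm_zero, zero_add, h1] at h3
  have := norm_add_le (Q.grad₁ i (x i) v t - (P.grad₁ i (x i) (P.agg x) + p₁ x)) (p₁ x)
  rw [show Q.grad₁ i (x i) v t - (P.grad₁ i (x i) (P.agg x) + p₁ x) + p₁ x
    = Q.grad₁ i (x i) v t - P.grad₁ i (x i) (P.agg x) by abel] at this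
  linarith

lemma Reconstructs.norm_grad₂_sub_le {Lhx Lhσ : ℝ} (hrec : Q.Reconstructs P K θstar ε) (hK : 0 < K)
    (hs : Q.SmoothProxies Lhx Lhσ) (hL : 0 ≤ Lhσ) (i : Fin N) (x : Stack n) (v : Vec d)
    (t : Vec (m i)) :
    ‖Q.grad₂ i (x i) v t - P.grad₂ i (x i) (P.agg x)‖
      ≤ ε + Lhσ * (‖v - P.agg x‖ + ‖t - θstar i‖) := by
  obtain ⟨p₁, p₂, pℓ, -, -, -, hp⟩ := hrec i
  obtain ⟨-, h1, -, -, h2, -⟩ := hp x 1 (Finset.mem_Icc.2 ⟨le_rfl, hK⟩)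
  have h3 := (hs.lip_grad₂ i).norm_sub_le hL (x i) (x i) v (P.agg x) t (θstar i)
  rw [sub_self, norm_zero, zero_add, h1] at h3
  have := norm_add_le (Q.grad₂ i (x i) v t - (P.grad₂ i (x i) (P.agg x) + p₂ x)) (p₂ x)
  rw [show Q.grad₂ i (x i) v t - (P.grad₂ i (x i) (P.agg x) + p₂ x) + p₂ x
    = Q.grad₂ i (x i) v t - P.grad₂ i (x i) (P.agg x) by abel] at this
  linarith

end Learner

/-! ### Consensus and tracking errors along the algorithm -/

/-- Deviation of a family of vectors from its mean. -/
def center {N : ℕ} {F : Type*} [NormedAddCommGroup F] [NormedSpace ℝ F] (v : Fin N → F) :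
    Fin N → F := fun i => v i - (1 / (N : ℝ)) • ∑ j, v j

lemma sum_center {N : ℕ} {F : Type*} [NormedAddCommGroup F] [NormedSpace ℝ F] (v : Fin N → F) :
    ∑ i, center v i = 0 := by
  rcases Nat.eq_zero_or_pos N with rfl | hN
  · simp
  have hN' : (N : ℝ) ≠ 0 := by positivity
  simp only [center]
  rw [Finset.sum_sub_distrib, Finset.sum_const, Finset.card_univ, Fintype.card_fin,
    ← Nat.cast_smul_eq_nsmul ℝ, smul_smul, mul_one_div_cancel hN', one_smul, sub_self]

lemma norm_center_le {N : ℕ} {F : Type*} [NormedAddCommGroup F] [NormedSpace ℝ F] (v : Fin N → F)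
    {R : ℝ} (hR : 0 ≤ R) (h : ∀ i, ‖v i‖ ≤ R) : ‖center v‖ ≤ 2 * R :=
  (pi_norm_le_iff_of_nonneg (by positivity)).2 fun i => by
    rw [two_mul]
    exact (norm_sub_le _ _).trans (add_le_add (h i) (norm_avg_le v hR h))

section
variable {N : ℕ} {n : Fin N → ℕ} {d : ℕ} {m : Fin N → ℕ}
  (P : Problem N n d) (Q : Learner N n d m)

namespace State

/-- Consensus error of the estimates of the aggregative variable. -/
def consErr (S : State N n d m) : Fin N → Vec d := fun i => S.sig P i - P.agg S.x

/-- Consensus error of the estimates of the mean of the `u₂`. -/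
def trackErr (S : State N n d m) : Fin N → Vec d := fun i =>
  S.z i + (S.u₂ P Q i - (1 / (N : ℝ)) • ∑ j, S.u₂ P Q j)

/-- Learning error. -/
def learnErr (θstar : Stack m) (S : State N n d m) : ∀ i, Vec (m i) := fun i => S.θ i - θstar i

/-- Learning error in the averaged coordinate. -/
def avgLearnErr (K : ℕ) (θstar : Stack m) (γ : ℝ) (k : ℕ) (S : State N n d m) :
    ∀ i, Vec (m i) := fun i =>
  S.θ i + γ • Q.corrector K i k (S.x i) (S.sig P i) (S.θ i) - θstar i

variable {P Q}

lemma consErr_eq (S : State N n d m) :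
    S.consErr P = (S.w : Fin N → Vec d) + center fun i => P.φ i (S.x i) := by
  ext1 i
  simp only [consErr, sig, Problem.agg, center, Pi.add_apply]
  abel

lemma trackErr_eq (S : State N n d m) :
    S.trackErr P Q = (S.z : Fin N → Vec d) + center (S.u₂ P Q) := rfl

end State

variable {P Q}

/-- Constants are fixed by mixing, so only the disagreement is mixed; the new input enters through
its deviation from the mean, which preserves the zero sum. -/
lemma consErr_step (hA : P.A ∈ doublyStochastic ℝ (Fin N)) (γ : ℝ) (k : ℕ) (S : State N n d m) :
    (step P Q γ k S).consErr P = mix P.A (S.consErr P)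
      + center (fun i => P.φ i ((step P Q γ k S).x i) - P.φ i (S.x i)) := by
  have h1 : mix P.A (fun i => S.sig P i) = mix P.A (S.consErr P) + fun _ => P.agg S.x := by
    rw [← mix_const hA (P.agg S.x), ← mix_add]
    congr 1; ext1 i; simp [State.consErr]
  ext1 i
  have h2 : (step P Q γ k S).w i = mix P.A (fun i => S.sig P i) i - P.φ i (S.x i) := rfl
  rw [State.consErr, State.sig, h2, h1]
  simp only [Pi.add_apply, center, Problem.agg, Finset.sum_sub_distrib, smul_sub]
  abel

lemma sig_step_sub (hA : P.A ∈ doublyStochastic ℝ (Fin N)) (γ : ℝ) (k : ℕ) (S : State N n d m)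
    (i : Fin N) :
    (step P Q γ k S).sig P i - S.sig P i = mix P.A (S.consErr P) i - S.consErr P i
      + (P.φ i ((step P Q γ k S).x i) - P.φ i (S.x i)) := by
  have h1 : mix P.A (fun i => S.sig P i) = mix P.A (S.consErr P) + fun _ => P.agg S.x := by
    rw [← mix_const hA (P.agg S.x), ← mix_add]
    congr 1; ext1 i; simp [State.consErr]
  have h2 : (step P Q γ k S).w i = mix P.A (fun i => S.sig P i) i - P.φ i (S.x i) := rfl
  rw [State.sig, h2, h1]
  simp only [Pi.add_apply, State.consErr]
  abel

lemma trackErr_step (hA : P.A ∈ doublyStochastic ℝ (Fin N)) (γ : ℝ) (k : ℕ) (S : State N n d m) :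
    (step P Q γ k S).trackErr P Q = mix P.A (S.trackErr P Q)
      + center (fun i => (step P Q γ k S).u₂ P Q i - S.u₂ P Q i) := by
  have h1 : mix P.A (fun i => S.z i + S.u₂ P Q i)
      = mix P.A (S.trackErr P Q) + fun _ => (1 / (N : ℝ)) • ∑ j, S.u₂ P Q j := by
    rw [← mix_const hA ((1 / (N : ℝ)) • ∑ j, S.u₂ P Q j), ← mix_add]
    congr 1; ext1 i; simp only [State.trackErr, Pi.add_apply]; abel
  ext1 i
  have h2 : (step P Q γ k S).z i = mix P.A (fun i => S.z i + S.u₂ P Q i) i - S.u₂ P Q i := rfl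
  rw [State.trackErr, h2, h1]
  simp only [Pi.add_apply, center, Finset.sum_sub_distrib, smul_sub]
  abel

lemma sum_consErr_traj (hA : P.A ∈ doublyStochastic ℝ (Fin N)) (γ : ℝ) {S₀ : State N n d m}
    (hw : S₀.w = 0) (k : ℕ) : ∑ i, (traj P Q γ S₀ k).consErr P i = 0 := by
  induction k with
  | zero => simp [traj, State.consErr_eq, hw, sum_center]
  | succ k ih =>
    simp [traj, consErr_step hA, Finset.sum_add_distrib, sum_mix hA, ih, sum_center]

lemma sum_trackErr_traj (hA : P.A ∈ doublyStochastic ℝ (Fin N)) (γ : ℝ) {S₀ : State N n d m}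
    (hz : S₀.z = 0) (k : ℕ) : ∑ i, (traj P Q γ S₀ k).trackErr P Q i = 0 := by
  induction k with
  | zero => simp [traj, State.trackErr_eq, hz, sum_center]
  | succ k ih =>
    simp [traj, trackErr_step hA, Finset.sum_add_distrib, sum_mix hA, ih, sum_center]

/-! ### The one-step error recursion -/

variable {μf L Lx Lσ Lφ Lhx Lhσ μℓ Lℓ ε γ : ℝ} {K : ℕ} {θstar : Stack m} {rbar : Fin N → ℝ}

/-- The optimization update is an inexact gradient step for the global cost. -/
lemma norm_step_x_sub_le (hP : P.Regular μf L Lx Lσ Lφ) (hK : 0 < K)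
    (hs : Q.SmoothProxies Lhx Lhσ) (hLhx : 0 ≤ Lhx) (hLhσ : 0 ≤ Lhσ)
    (hrec : Q.Reconstructs P K θstar ε) (hε : 0 ≤ ε) (hγ : 0 ≤ γ) (k : ℕ) (S : State N n d m) :
    ‖(step P Q γ k S).x - (S.x - γ • gradient P.cost S.x)‖
      ≤ γ * (N * ((1 + Lhx + Lφ * (2 + Lhσ)) *
        (‖S.consErr P‖ + ‖S.trackErr P Q‖ + ‖S.learnErr θstar‖ + ε))) := by
  set b := ‖S.consErr P‖
  set c := ‖S.trackErr P Q‖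
  set q := ‖S.learnErr θstar‖
  have hLφ := hP.Lφ_pos.le
  have hb : 0 ≤ b := norm_nonneg _
  have hc : 0 ≤ c := norm_nonneg _
  have hq : 0 ≤ q := norm_nonneg _
  have hbi : ∀ i, ‖S.sig P i - P.agg S.x‖ ≤ b := fun i => norm_le_pi_norm (S.consErr P) i
  have hqi : ∀ i, ‖S.θ i - θstar i‖ ≤ q := fun i => norm_le_pi_norm (S.learnErr θstar) i
  have e : (step P Q γ k S).x - (S.x - γ • gradient P.cost S.x)
      = -(γ • WithLp.toLp 2 fun i => (S.u₁ P Q i + P.gradφ i (S.x i) (S.z i + S.u₂ P Q i))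
        - gradient P.cost S.x i) := by
    ext1 i
    simp only [step, PiLp.sub_apply, PiLp.smul_apply, PiLp.neg_apply, smul_sub]
    abel
  rw [e, norm_neg, norm_smul, Real.norm_of_nonneg hγ]
  refine mul_le_mul_of_nonneg_left (Stack.norm_le _ (by positivity) fun i => ?_) hγ
  change ‖(S.u₁ P Q i + P.gradφ i (S.x i) (S.z i + S.u₂ P Q i)) - gradient P.cost S.x i‖ ≤ _
  -- The tracker differs from the mean of the true ∇₂ by the tracking error and the mean proxy
  -- error.
  have e2 : (S.u₁ P Q i + P.gradφ i (S.x i) (S.z i + S.u₂ P Q i)) - gradient P.cost S.x i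
      = (S.u₁ P Q i - P.grad₁ i (S.x i) (P.agg S.x)) + P.gradφ i (S.x i) (S.trackErr P Q i
        + (1 / (N : ℝ)) • ∑ j, (S.u₂ P Q j - P.grad₂ j (S.x j) (P.agg S.x))) := by
    have e3 : S.z i + S.u₂ P Q i = S.trackErr P Q i
        + (1 / (N : ℝ)) • ∑ j, (S.u₂ P Q j - P.grad₂ j (S.x j) (P.agg S.x))
        + (1 / (N : ℝ)) • ∑ j, P.grad₂ j (S.x j) (P.agg S.x) := by
      rw [State.trackErr, Finset.sum_sub_distrib, smul_sub]; abel
    rw [hP.gradient_cost_apply, e3, map_add]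
    abel
  have h1 : ‖S.u₁ P Q i - P.grad₁ i (S.x i) (P.agg S.x)‖ ≤ ε + Lhx * (b + q) :=
    (hrec.norm_grad₁_sub_le hK hs hLhx i S.x _ _).trans (by gcongr; exacts [hbi i, hqi i])
  have h2 : ∀ j, ‖S.u₂ P Q j - P.grad₂ j (S.x j) (P.agg S.x)‖ ≤ ε + Lhσ * (b + q) := fun j =>
    (hrec.norm_grad₂_sub_le hK hs hLhσ j S.x _ _).trans (by gcongr; exacts [hbi j, hqi j])
  have h3 : ‖S.trackErr P Q i
        + (1 / (N : ℝ)) • ∑ j, (S.u₂ P Q j - P.grad₂ j (S.x j) (P.agg S.x))‖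
      ≤ c + (ε + Lhσ * (b + q)) :=
    (norm_add_le _ _).trans (add_le_add (norm_le_pi_norm (S.trackErr P Q) i)
      (norm_avg_le _ (by positivity) h2))
  have h4 := (hP.norm_gradφ_le i (S.x i) _).trans (mul_le_mul_of_nonneg_left h3 hLφ)
  rw [e2]
  refine (norm_add_le _ _).trans ((add_le_add h1 h4).trans ?_)
  have : 0 ≤ Lφ * Lhσ := mul_nonneg hLφ hLhσ
  nlinarith [mul_nonneg hLhx hc, mul_nonneg hLhx hε, mul_nonneg hLφ hb, mul_nonneg hLφ hc,
    mul_nonneg hLφ hq, mul_nonneg hLφ hε, mul_nonneg this hc, mul_nonneg this hε]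

lemma norm_step_φ_sub_le (hP : P.Regular μf L Lx Lσ Lφ) (k : ℕ) (S : State N n d m) (i : Fin N) :
    ‖P.φ i ((step P Q γ k S).x i) - P.φ i (S.x i)‖ ≤ Lφ * ‖(step P Q γ k S).x - S.x‖ := by
  refine (hP.lip_φ i _ _).trans (mul_le_mul_of_nonneg_left ?_ hP.Lφ_pos.le)
  exact PiLp.norm_apply_le ((step P Q γ k S).x - S.x) i

/-- Mixing alone moves the estimates by an amount comparable to their disagreement, with no factor
γ. This is the origin of the terms C b in `c_le` and γ C b in `p_le`. -/
lemma norm_step_sig_sub_le (hP : P.Regular μf L Lx Lσ Lφ)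
    (hA : P.A ∈ doublyStochastic ℝ (Fin N)) (k : ℕ) (S : State N n d m) (i : Fin N) :
    ‖(step P Q γ k S).sig P i - S.sig P i‖
      ≤ 2 * ‖S.consErr P‖ + Lφ * ‖(step P Q γ k S).x - S.x‖ := by
  rw [sig_step_sub hA]
  have h1 := (norm_le_pi_norm (mix P.A (S.consErr P)) i).trans (norm_mix_le hA _)
  have h2 := norm_le_pi_norm (S.consErr P) i
  have h3 := norm_step_φ_sub_le (Q := Q) (γ := γ) hP k S i
  refine (norm_add_le _ _).trans (add_le_add ((norm_sub_le _ _).trans ?_) h3)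
  linarith

/-- The one-step error recursion. -/
lemma exists_errStep {ρ M : ℝ} {ν : (Fin N → Vec d) → ℝ} (hP : P.Regular μf L Lx Lσ Lφ)
    (hA : P.A ∈ doublyStochastic ℝ (Fin N)) (hM : 1 ≤ M) (hν1 : ∀ e, ‖e‖ ≤ ν e)
    (hν2 : ∀ e, ν e ≤ M * ‖e‖) (hν3 : ∀ e e', ν (e + e') ≤ ν e + ν e')
    (hν4 : ∀ e, ∑ i, e i = 0 → ν (mix P.A e) ≤ ρ * ν e)
    {xstar : Stack n} (hx : IsMinOn P.cost Set.univ xstar)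
    (hLhx : 0 < Lhx) (hLhσ : 0 < Lhσ) (hμℓ : 0 < μℓ) (hLℓ : 0 < Lℓ) (hK : 0 < K) {η : ℝ}
    (hη1 : η ≤ 1) (hη : Lℓ * η ≤ μℓ / 4) :
    ∃ C γ₀ : ℝ, 1 ≤ C ∧ 0 < γ₀ ∧ ∀ (m : Fin N → ℕ) (Q : Learner N n d m) (θstar : Stack m)
      (rbar : Fin N → ℝ) (ε : ℝ), 0 ≤ ε → Q.SmoothProxies Lhx Lhσ →
      Q.GoodLearning K μℓ Lℓ θstar rbar → Q.Reconstructs P K θstar ε →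
      ∀ γ, 0 < γ → γ ≤ γ₀ → ∀ (k : ℕ) (S S' : State N n d m), S' = step P Q γ k S →
      ∑ i, S.consErr P i = 0 → ∑ i, S.trackErr P Q i = 0 →
      (∀ i, ‖S.avgLearnErr P Q K θstar γ k i‖ ≤ (1 + η) * rbar i) →
      ErrStep (μf / 4) (μℓ / 16) ρ C γ ε ‖S.x - xstar‖ (ν (S.consErr P)) (ν (S.trackErr P Q))
        ‖S.avgLearnErr P Q K θstar γ k‖ ‖S'.x - xstar‖ (ν (S'.consErr P)) (ν (S'.trackErr P Q))
        ‖S'.avgLearnErr P Q K θstar γ (k + 1)‖ ∧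
      ∀ i, ‖S'.avgLearnErr P Q K θstar γ (k + 1) i‖
        ≤ (1 - γ * (μℓ / 16)) * ‖S.avgLearnErr P Q K θstar γ k i‖ + γ * C * ν (S.consErr P)
          + γ ^ 2 * C * (‖S.x - xstar‖ + ν (S.consErr P) + ν (S.trackErr P Q)
            + ‖S.avgLearnErr P Q K θstar γ k‖ + ε) := by
  have hLφ := hP.Lφ_pos
  have hL := hP.L_pos
  have hμf := hP.μf_pos
  have hM0 : 0 < M := by linarith
  obtain ⟨C₁, hC₁⟩ : ∃ C₁, C₁ = N * (1 + Lhx + Lφ * (2 + Lhσ)) := ⟨_, rfl⟩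
  have hC₁0 : 0 ≤ C₁ := by rw [hC₁]; positivity
  have hK0 : (0 : ℝ) ≤ K := by positivity
  obtain ⟨C, hC⟩ : ∃ C, C = 2 + C₁ + L + Lℓ + Lφ + 2 * M * Lφ + 2 * M * Lhσ + 2 * K * Lℓ
    + 2 * K * Lℓ * (1 + Lℓ) + 2 * K * (1 + Lℓ) := ⟨_, rfl⟩
  have p1 : 0 < M * Lφ := by positivity
  have p2 : 0 < M * Lhσ := by positivity
  have p3 : 0 ≤ K * Lℓ := by positivity
  have p4 : 0 ≤ K * Lℓ * (1 + Lℓ) := by positivity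
  have p5 : 0 ≤ K * (1 + Lℓ) := by positivity
  have d1 : C₁ ≤ C := by linarith
  have d2 : L + C₁ ≤ C := by linarith
  have d3 : 1 + Lℓ ≤ C := by linarith
  have d4 : 2 + Lφ ≤ C := by linarith
  have d5 : 2 * M * Lφ ≤ C := by linarith
  have d6 : 2 * M * Lhσ ≤ C := by linarith
  have d7 : 2 * K * Lℓ ≤ C := by linarith
  have d8 : 2 * K * Lℓ * (1 + Lℓ) ≤ C := by linarith
  have d9 : 2 * K * (1 + Lℓ) ≤ C := by linarith
  have d10 : 1 ≤ C := by linarith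
  have hC0 : 0 < C := by linarith
  clear hC
  have hC3 : 1 ≤ 8 * C ^ 3 := by
    have := one_le_pow₀ d10 (n := 3)
    linarith
  -- The bound 1/(2C) serves the elimination of increments; the two pairs are the step conditions of
  -- `norm_sub_smul_sub_le`, with modulus μf/2 for the cost and μℓ/8 for the averaged loss.
  refine ⟨8 * C ^ 3, min (min (1 / (2 * C)) (min (μf / 2 / L ^ 2) (4 / μf)))
    (min (μℓ / 8 / Lℓ ^ 2) (16 / μℓ)), hC3, by positivity, ?_⟩
  intro m Q θstar rbar ε hε hs hl hrec γ hγ hγ₀ k S S' hS' hsum1 hsum2 hball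
  simp only [le_min_iff] at hγ₀
  obtain ⟨⟨g1, g2, g3⟩, g4, g5⟩ := hγ₀
  have g1 : γ * C ≤ 1 / 2 := by
    calc γ * C ≤ 1 / (2 * C) * C := by gcongr
      _ = 1 / 2 := by field_simp
  rw [le_div_iff₀ (by positivity)] at g2 g3 g4 g5
  have i1 : ‖S.consErr P‖ ≤ ν (S.consErr P) := hν1 _
  have i2 : ‖S.trackErr P Q‖ ≤ ν (S.trackErr P Q) := hν1 _
  have b0 := norm_nonneg (S.consErr P)
  have c0 := norm_nonneg (S.trackErr P Q)
  have q0 := norm_nonneg (S.learnErr θstar)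
  have p0 := norm_nonneg (S.avgLearnErr P Q K θstar γ k)
  have a0 := norm_nonneg (S.x - xstar)
  have hbi : ∀ i, ‖S.sig P i - P.agg S.x‖ ≤ ‖S.consErr P‖ := norm_le_pi_norm (S.consErr P)
  have hqi : ∀ i, ‖S.θ i - θstar i‖ ≤ ‖S.learnErr θstar‖ := norm_le_pi_norm (S.learnErr θstar)
  have hxs := norm_step_x_sub_le hP hK hs hLhx.le hLhσ.le hrec hε hγ.le k S
  have hφs := norm_step_φ_sub_le (Q := Q) (γ := γ) hP k S
  have hsig := norm_step_sig_sub_le (Q := Q) (γ := γ) hP hA k S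
  have hcons := consErr_step (Q := Q) hA γ k S
  have htrack := trackErr_step (Q := Q) hA γ k S
  have hθ' : ∀ i, S'.θ i = S.θ i - γ • Q.ditherGrad i k (S.x i) (S.sig P i) (S.θ i) := by
    rw [hS']; intro i; rfl
  rw [← hS'] at hxs hφs hsig hcons htrack
  have hxs' : ‖S'.x - (S.x - γ • gradient P.cost S.x)‖ ≤ γ * (C₁ *
      (ν (S.consErr P) + ν (S.trackErr P Q) + ‖S.learnErr θstar‖ + ε)) := by
    rw [hC₁, mul_assoc (N : ℝ)]
    refine hxs.trans ?_
    gcongr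
  clear hxs
  -- the sample gradients
  have hg : ∀ i τ, ‖Q.ditherGrad i τ (S.x i) (S.sig P i) (S.θ i)‖
      ≤ (1 + Lℓ) * (ν (S.consErr P) + ‖S.learnErr θstar‖ + ε) := fun i τ => by
    have h1 := hl.norm_ditherGrad_le hK hLℓ.le hrec i τ S.x (S.sig P i) (S.θ i)
    have h2 : Lℓ * (‖S.sig P i - P.agg S.x‖ + ‖S.θ i - θstar i‖)
        ≤ Lℓ * (ν (S.consErr P) + ‖S.learnErr θstar‖) := by
      gcongr
      exacts [(hbi i).trans i1, hqi i]
    have h3 : 0 ≤ Lℓ * ε := by positivity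
    linarith
  have hR0 : 0 ≤ ν (S.consErr P) + ‖S.learnErr θstar‖ + ε := by linarith
  have hcor : ∀ i, ‖Q.corrector K i k (S.x i) (S.sig P i) (S.θ i)‖
      ≤ C * (ν (S.consErr P) + ‖S.learnErr θstar‖ + ε) := fun i =>
    (Learner.GoodLearning.norm_corrector_le hK (by positivity) (hg i) k).trans (by
      rw [← mul_assoc]; gcongr)
  -- the cost gradient
  have hgs : gradient P.cost xstar = 0 := by
    have h1 : IsLocalMin P.cost xstar := Filter.Eventually.of_forall fun y => hx (Set.mem_univ y)
    rw [gradient, h1.fderiv_eq_zero, map_zero]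
  have hgL : ‖gradient P.cost S.x‖ ≤ L * ‖S.x - xstar‖ := by
    simpa [hgs] using hP.lip_grad_cost S.x xstar
  have hdescent : ‖S.x - γ • gradient P.cost S.x - xstar‖
      ≤ (1 - γ * (μf / 4)) * ‖S.x - xstar‖ := by
    have := norm_sub_smul_sub_le (t := S.x) (y := xstar) hγ.le
      (StrongConvexOn.le_inner_gradient_of_isMinOn hP.strongConvex (Set.mem_univ _)
        (Set.mem_univ _) (hP.diff_cost _) hx) hgL g2 (by linarith)
    refine this.trans_eq (by ring)
  have hdx : ‖S'.x - S.x‖ ≤ γ * C * (‖S.x - xstar‖ + ν (S.consErr P) + ν (S.trackErr P Q)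
      + ‖S.learnErr θstar‖ + ε) := by
    have e : S'.x - S.x = (S'.x - (S.x - γ • gradient P.cost S.x)) - γ • gradient P.cost S.x := by
      abel
    have h1 : ‖S'.x - S.x‖ ≤ γ * (C₁ * (ν (S.consErr P) + ν (S.trackErr P Q)
        + ‖S.learnErr θstar‖ + ε)) + γ * (L * ‖S.x - xstar‖) := by
      rw [e]
      refine (norm_sub_le _ _).trans (add_le_add hxs' ?_)
      rw [norm_smul, Real.norm_of_nonneg hγ.le]
      gcongr
    refine h1.trans ?_
    rw [← mul_add, mul_assoc γ C]
    refine mul_le_mul_of_nonneg_left ?_ hγ.le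
    have h2 : C₁ * (ν (S.consErr P) + ν (S.trackErr P Q) + ‖S.learnErr θstar‖ + ε)
        ≤ C * (ν (S.consErr P) + ν (S.trackErr P Q) + ‖S.learnErr θstar‖ + ε) := by
      gcongr
      linarith
    have h3 : L * ‖S.x - xstar‖ ≤ C * ‖S.x - xstar‖ := by
      gcongr; linarith
    linarith
  have ha' : ‖S'.x - xstar‖ ≤ (1 - γ * (μf / 4)) * ‖S.x - xstar‖ + γ * C *
      (ν (S.consErr P) + ν (S.trackErr P Q) + ‖S.learnErr θstar‖ + ε) := by
    have e : S'.x - xstar = (S.x - γ • gradient P.cost S.x - xstar)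
        + (S'.x - (S.x - γ • gradient P.cost S.x)) := by abel
    rw [e]
    refine (norm_add_le _ _).trans (add_le_add hdescent (hxs'.trans ?_))
    rw [← mul_assoc]
    gcongr
    linarith
  obtain ⟨dx, hdx_eq⟩ : ∃ dx, dx = ‖S'.x - S.x‖ := ⟨_, rfl⟩
  obtain ⟨ds, hds_eq⟩ : ∃ ds, ds = ‖fun i => S'.sig P i - S.sig P i‖ := ⟨_, rfl⟩
  obtain ⟨dθ, hdθ_eq⟩ : ∃ dθ, dθ = ‖fun i => S'.θ i - S.θ i‖ := ⟨_, rfl⟩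
  rw [← hdx_eq] at hdx hφs hsig
  have dx0 : 0 ≤ dx := hdx_eq ▸ norm_nonneg _
  have ds0 : 0 ≤ ds := hds_eq ▸ norm_nonneg _
  have dθ0 : 0 ≤ dθ := hdθ_eq ▸ norm_nonneg _
  have hdxi : ∀ i, ‖S'.x i - S.x i‖ ≤ dx := fun i => by
    rw [hdx_eq]; exact PiLp.norm_apply_le (S'.x - S.x) i
  have hdsi : ∀ i, ‖S'.sig P i - S.sig P i‖ ≤ ds := fun i => by
    rw [hds_eq]; exact norm_le_pi_norm (fun i => S'.sig P i - S.sig P i) i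
  have hdθi : ∀ i, ‖S'.θ i - S.θ i‖ ≤ dθ := fun i => by
    rw [hdθ_eq]; exact norm_le_pi_norm (fun i => S'.θ i - S.θ i) i
  have hds : ds ≤ C * (ν (S.consErr P) + dx) := by
    rw [hds_eq]
    refine (pi_norm_le_iff_of_nonneg (mul_nonneg hC0.le (by linarith))).2 fun i =>
      (hsig i).trans ?_
    have h1 : 2 * ‖S.consErr P‖ ≤ C * ν (S.consErr P) := by
      have : (2 : ℝ) ≤ C := by linarith
      gcongr
    have h2 : Lφ * dx ≤ C * dx := by gcongr; linarith
    linarith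
  have hdθ : dθ ≤ γ * C * (ν (S.consErr P) + ‖S.learnErr θstar‖ + ε) := by
    rw [hdθ_eq]
    refine (pi_norm_le_iff_of_nonneg (by positivity)).2 fun i => ?_
    rw [hθ', sub_sub_cancel_left, norm_neg, norm_smul, Real.norm_of_nonneg hγ.le, mul_assoc]
    refine mul_le_mul_of_nonneg_left ((hg i k).trans ?_) hγ.le
    gcongr
  have hb' : ν (S'.consErr P) ≤ ρ * ν (S.consErr P) + C * dx := by
    rw [hcons]
    refine (hν3 _ _).trans (add_le_add (hν4 _ hsum1) ((hν2 _).trans ?_))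
    calc _ ≤ M * (2 * (Lφ * dx)) := by
          gcongr
          exact norm_center_le _ (by positivity) hφs
      _ = 2 * M * Lφ * dx := by ring
      _ ≤ C * dx := by gcongr
  have hu₂ : ∀ i, ‖S'.u₂ P Q i - S.u₂ P Q i‖ ≤ Lhσ * (dx + ds + dθ) := fun i => by
    refine ((hs.lip_grad₂ i).norm_sub_le hLhσ.le _ _ _ _ _ _).trans ?_
    gcongr
    exacts [hdxi i, hdsi i, hdθi i]
  have hc' : ν (S'.trackErr P Q) ≤ ρ * ν (S.trackErr P Q) + C * (dx + ds + dθ) := by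
    rw [htrack]
    refine (hν3 _ _).trans (add_le_add (hν4 _ hsum2) ((hν2 _).trans ?_))
    calc _ ≤ M * (2 * (Lhσ * (dx + ds + dθ))) := by
          gcongr
          exact norm_center_le _ (by positivity) hu₂
      _ = 2 * M * Lhσ * (dx + ds + dθ) := by ring
      _ ≤ C * (dx + ds + dθ) := by gcongr
  have hq : ‖S.learnErr θstar‖ ≤ ‖S.avgLearnErr P Q K θstar γ k‖
      + γ * C * (ν (S.consErr P) + ‖S.learnErr θstar‖ + ε) := by
    refine (pi_norm_le_iff_of_nonneg (by positivity)).2 fun i => ?_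
    have e : S.learnErr θstar i = S.avgLearnErr P Q K θstar γ k i
        - γ • Q.corrector K i k (S.x i) (S.sig P i) (S.θ i) := by
      simp only [State.learnErr, State.avgLearnErr]; abel
    rw [e]
    refine (norm_sub_le _ _).trans (add_le_add (norm_le_pi_norm _ i) ?_)
    rw [norm_smul, Real.norm_of_nonneg hγ.le, mul_assoc]
    exact mul_le_mul_of_nonneg_left (hcor i) hγ.le
  have hp' : ∀ i, ‖S'.avgLearnErr P Q K θstar γ (k + 1) i‖
      ≤ (1 - γ * (μℓ / 16)) * ‖S.avgLearnErr P Q K θstar γ k i‖ + γ * C * (dx + ds + dθ)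
        + γ ^ 2 * C * (ν (S.consErr P) + ‖S.learnErr θstar‖ + ε) := fun i => by
    have h1 := hl.averaged_step hK hμℓ.le hLℓ.le hη1 hη hγ.le g4 (by linarith) i k (S.x i) (S'.x i)
      (S.sig P i) (S'.sig P i) (S.θ i) (by positivity) (hg i) (hball i)
    rw [← hθ' i] at h1
    refine h1.trans ?_
    refine add_le_add (add_le_add le_rfl ?_) ?_
    · gcongr
      exacts [hdxi i, hdsi i, hdθi i]
    · calc _ = γ ^ 2 * (2 * K * Lℓ * (1 + Lℓ)) * (ν (S.consErr P) + ‖S.learnErr θstar‖ + ε) := by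
            ring
        _ ≤ _ := by gcongr
  have hν0 : 0 ≤ 1 - γ * (μℓ / 16) := by linarith
  have hpp : ‖S'.avgLearnErr P Q K θstar γ (k + 1)‖
      ≤ (1 - γ * (μℓ / 16)) * ‖S.avgLearnErr P Q K θstar γ k‖ + γ * C * (dx + ds + dθ)
        + γ ^ 2 * C * (ν (S.consErr P) + ‖S.learnErr θstar‖ + ε) :=
    (pi_norm_le_iff_of_nonneg (by positivity)).2 fun i => (hp' i).trans (by
      gcongr
      exact norm_le_pi_norm _ i)
  refine ⟨ErrStep.of_increments d10 hγ g1 hε a0 (b0.trans i1) (c0.trans i2) p0 hq hdx hdθ hds ha'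
    hb' hc' hpp, fun i => ?_⟩
  -- The bound for a single agent must contract that agent's own error, not the sup norm. The
  -- artificial `p'` adds the agent's excess over its contraction to the contracted sup norm, so
  -- that the same elimination applies and the sup-norm part cancels.
  have := (ErrStep.of_increments (ν := μℓ / 16)
    (p' := (1 - γ * (μℓ / 16)) * ‖S.avgLearnErr P Q K θstar γ k‖
      + (‖S'.avgLearnErr P Q K θstar γ (k + 1) i‖
        - (1 - γ * (μℓ / 16)) * ‖S.avgLearnErr P Q K θstar γ k i‖))
    d10 hγ g1 hε a0 (b0.trans i1) (c0.trans i2) p0 hq hdx hdθ hds ha' hb' hc' (by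
      linarith [hp' i])).p_le
  linarith

lemma norm_le_norm_errVec (xstar : Stack n) (θstar : Stack m) (S : State N n d m) :
    ‖S.x - xstar‖ ≤ ‖errVec P Q xstar θstar S‖ ∧ ‖S.consErr P‖ ≤ ‖errVec P Q xstar θstar S‖ ∧
    ‖S.trackErr P Q‖ ≤ ‖errVec P Q xstar θstar S‖ ∧
    ‖S.learnErr θstar‖ ≤ ‖errVec P Q xstar θstar S‖ := by
  have h1 := WithLp.norm_snd_le _ (errVec P Q xstar θstar S)
  have h2 := WithLp.norm_snd_le _ (errVec P Q xstar θstar S).snd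
  refine ⟨WithLp.norm_fst_le _ (errVec P Q xstar θstar S),
    (pi_norm_le_iff_of_nonneg (norm_nonneg _)).2 fun i => ?_,
    (pi_norm_le_iff_of_nonneg (norm_nonneg _)).2 fun i => ?_,
    (pi_norm_le_iff_of_nonneg (norm_nonneg _)).2 fun i => ?_⟩
  · exact (PiLp.norm_apply_le (errVec P Q xstar θstar S).snd.fst i).trans
      ((WithLp.norm_fst_le _ _).trans h1)
  · exact (PiLp.norm_apply_le (errVec P Q xstar θstar S).snd.snd.fst i).trans
      ((WithLp.norm_fst_le _ _).trans (h2.trans h1))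
  · exact (PiLp.norm_apply_le (errVec P Q xstar θstar S).snd.snd.snd i).trans
      ((WithLp.norm_snd_le _ _).trans (h2.trans h1))

end

end AggLearn

end

/-! ### Assembly of the convergence estimate -/

theorem theorem1 {N : ℕ} {n : Fin N → ℕ} {d : ℕ} (P : AggLearn.Problem N n d)
    (μf L Lx Lσ Lφ : ℝ) (hP : P.Regular μf L Lx Lσ Lφ) (hG : P.GoodGraph)
    (xstar : AggLearn.Stack n) (hxstar : IsMinOn P.cost Set.univ xstar)
    (Lhx Lhσ μℓ Lℓ : ℝ) (hLhx : 0 < Lhx) (hLhσ : 0 < Lhσ) (hμℓ : 0 < μℓ) (hLℓ : 0 < Lℓ)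
    (K : ℕ) (hK : 0 < K) :
    ∃ (B κ₁ : ℝ) (κ₂ : ℝ → ℝ), 0 < B ∧ 0 < κ₁ ∧ (∀ γ, 0 < γ → κ₂ γ ∈ Set.Ioo (0 : ℝ) 1) ∧
      ∀ (m : Fin N → ℕ) (Q : AggLearn.Learner N n d m) (θstar : AggLearn.Stack m)
        (rbar : Fin N → ℝ) (ε : ℝ),
        0 ≤ ε → Q.SmoothProxies Lhx Lhσ → Q.GoodLearning K μℓ Lℓ θstar rbar →
        Q.Reconstructs P K θstar ε →
        ∀ S₀ : AggLearn.State N n d m,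
          (∀ i, S₀.θ i ∈ Metric.closedBall (θstar i) (rbar i)) → S₀.w = 0 → S₀.z = 0 →
          ∃ γbar : ℝ, 0 < γbar ∧ ∀ γ ∈ Set.Ioo (0 : ℝ) γbar, ∀ k : ℕ,
            ‖(AggLearn.traj P Q γ S₀ k).x - xstar‖
              ≤ κ₁ * κ₂ γ ^ k * ‖AggLearn.errVec P Q xstar θstar S₀‖ + ε * B := by
  obtain ⟨ρ, M₁, ν, hρ, hM, hν1, hν2, hν3, hν4⟩ :=
    AggLearn.exists_adapted_norm (F := AggLearn.Vec d) hG.doublyStochastic hG.aperiodic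
  obtain ⟨η, hη⟩ : ∃ η, η = min 1 (μℓ / 4 / Lℓ) := ⟨_, rfl⟩
  have hη0 : 0 < η := by rw [hη]; positivity
  have hη1 : η ≤ 1 := hη ▸ min_le_left _ _
  have hη2 : Lℓ * η ≤ μℓ / 4 := by
    have : η ≤ μℓ / 4 / Lℓ := hη ▸ min_le_right _ _
    rwa [le_div_iff₀ hLℓ, mul_comm] at this
  obtain ⟨C, γ₀, hC, hγ₀, hstep⟩ := AggLearn.exists_errStep hP hG.doublyStochastic hM hν1 hν2 hν3
    hν4 hxstar hLhx hLhσ hμℓ hLℓ hK hη1 hη2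
  have hμf := hP.μf_pos
  obtain ⟨κ, M, B, hκ, hM', hB, hbound⟩ := AggLearn.errStep_bound (α := μf / 4) (ν := μℓ / 16)
    (by positivity) (by positivity) hρ hC hη0
  have hM₁ : 0 < M₁ := by linarith
  -- The maximum with 1/2 keeps the rate positive for every γ > 0, including those with κ γ ≥ 1. In
  -- 2 + 2 M₁ the adapted norms of the two consensus errors contribute M₁ each.
  refine ⟨B, M * (2 + 2 * M₁), fun γ => max (1 / 2) (1 - κ * γ), hB, by positivity, fun γ hγ =>
    ⟨lt_max_of_lt_left (by norm_num), max_lt (by norm_num) (by nlinarith)⟩, ?_⟩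
  intro m Q θstar rbar ε hε hs hl hrec S₀ hθ hw hz
  have hev := hbound N rbar hl.rbar_pos ε ‖S₀.x - xstar‖ (ν (S₀.consErr P)) (ν (S₀.trackErr P Q))
    ‖S₀.learnErr θstar‖ hε
  have hev2 : ∀ᶠ γ : ℝ in nhdsWithin 0 (Set.Ioi 0), γ < γ₀ :=
    mem_nhdsWithin_of_mem_nhds (Iio_mem_nhds hγ₀)
  obtain ⟨γbar, hγbar, hsub⟩ := mem_nhdsGT_iff_exists_Ioo_subset.1
    ((hev.and hev2).and (AggLearn.eventually_mul_le κ one_pos))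
  refine ⟨γbar, hγbar, fun γ hγ k => ?_⟩
  obtain ⟨⟨h1, h2⟩, h3⟩ := hsub hγ
  -- At time 0 the corrector is an empty sum, so the initial data of the recursion do not depend on
  -- γ and start in the original balls.
  have hinit : S₀.avgLearnErr P Q K θstar γ 0 = S₀.learnErr θstar := by
    ext1 i
    simp [AggLearn.State.avgLearnErr, AggLearn.State.learnErr, AggLearn.Learner.corrector]
  have hν0 : ∀ e, 0 ≤ ν e := fun e => (norm_nonneg e).trans (hν1 e)
  have key := h1 (fun k => ‖(AggLearn.traj P Q γ S₀ k).x - xstar‖)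
    (fun k => ν ((AggLearn.traj P Q γ S₀ k).consErr P))
    (fun k => ν ((AggLearn.traj P Q γ S₀ k).trackErr P Q))
    (fun k => ‖(AggLearn.traj P Q γ S₀ k).avgLearnErr P Q K θstar γ k‖)
    (fun k i => ‖(AggLearn.traj P Q γ S₀ k).avgLearnErr P Q K θstar γ k i‖)
    rfl rfl rfl (by rw [← hinit]; rfl) (fun _ => norm_nonneg _) (fun _ => hν0 _) (fun _ => hν0 _)
    (fun _ => norm_nonneg _) (fun i => by
      have h := hθ i
      rw [Metric.mem_closedBall, dist_eq_norm] at h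
      change ‖S₀.avgLearnErr P Q K θstar γ 0 i‖ ≤ rbar i
      rwa [hinit])
    (fun k hk => hstep m Q θstar rbar ε hε hs hl hrec γ hγ.1 h2.le k _ _ rfl
      (AggLearn.sum_consErr_traj hG.doublyStochastic γ hw k)
      (AggLearn.sum_trackErr_traj hG.doublyStochastic γ hz k) hk) k
  refine key.trans (add_le_add ?_ le_rfl)
  obtain ⟨e1, e2, e3, e4⟩ := AggLearn.norm_le_norm_errVec (P := P) (Q := Q) xstar θstar S₀
  have hsum : ‖S₀.x - xstar‖ + ν (S₀.consErr P) + ν (S₀.trackErr P Q) + ‖S₀.learnErr θstar‖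
      ≤ (2 + 2 * M₁) * ‖AggLearn.errVec P Q xstar θstar S₀‖ := by
    have f2 := (hν2 (S₀.consErr P)).trans (mul_le_mul_of_nonneg_left e2 hM₁.le)
    have f3 := (hν2 (S₀.trackErr P Q)).trans (mul_le_mul_of_nonneg_left e3 hM₁.le)
    linarith
  have hpow : (1 - κ * γ) ^ k ≤ (max (1 / 2) (1 - κ * γ)) ^ k :=
    pow_le_pow_left₀ (by linarith) (le_max_right _ _) k
  have hnn : 0 ≤ (max (1 / 2) (1 - κ * γ)) ^ k := pow_nonneg (le_max_of_le_left (by norm_num)) k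
  calc M * (1 - κ * γ) ^ k * (‖S₀.x - xstar‖ + ν (S₀.consErr P) + ν (S₀.trackErr P Q)
        + ‖S₀.learnErr θstar‖)
      ≤ M * (max (1 / 2) (1 - κ * γ)) ^ k *
        ((2 + 2 * M₁) * ‖AggLearn.errVec P Q xstar θstar S₀‖) := by
        have := hν0 (S₀.consErr P)
        have := hν0 (S₀.trackErr P Q)
        gcongr
    _ = _ := by ring
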